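/- Let $k$ be a field of characteristic zero and let $H=\bigoplus_{n\ge 0}H_n$ be a connected graded Hopf algebra over $k$: a Hopf algebra with a grading for which it is both a graded algebra and a graded coalgebra, whose antipode preserves the grading, and with $H_0=k\cdot 1$. Let $K\subseteq H$ be a graded Hopf subalgebra, that is, a subalgebra with $K=\bigoplus_n (K\cap H_n)$, $\Delta(K)\subseteq K\otimes K$ and $S(K)\subseteq K$, where $\Delta$ is the comultiplication and $S$ the antipode of $H$. Write $H_+=\bigoplus_{n\ge1}H_n$. Then there are an indexed family $(z_\gamma)_{\gamma\in\Gamma}$ of homogeneous elements of $H$ of positive degree and a total order $\le$ on $\Gamma$ such that, with $H^{<\gamma}$ denoting the subalgebra of $H$ generated by $K$ and $\{z_\delta \mid \delta\in\Gamma,\ \delta<\gamma\}$, and $H^{<\gamma}_+=H^{<\gamma}\cap H_+$: 1. $\Delta(z_\gamma)\in 1\otimes z_\gamma+z_\gamma\otimes 1+(H^{<\gamma}_+\otimes H^{<\gamma}_+)_{\deg(z_\gamma)}$ for every $\gamma\in\Gamma$, where the subscript denotes the homogeneous part of that total degree; 2. $[z_\gamma,H^{<\gamma}]\subseteq H^{<\gamma}$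 for every $\gamma\in\Gamma$, where $[a,b]=ab-ba$; 3. the products $z_{\gamma_1}\cdots z_{\gamma_n}$, indexed by the finite nondecreasing sequences $\gamma_1\le\cdots\le\gamma_n$ in $\Gamma$ ($n\ge0$), form a homogeneous basis of $H$ as a left graded $K$-module and also as a right graded $K$-module; 4. $\operatorname{gkdim} H=\operatorname{gkdim} K+\#(\Gamma)$ in $[0,\infty]$, where $\#(\Gamma)\in\{0,1,2,\dots\}\cup\{\infty\}$ is the number of elements of $\Gamma$ and $\operatorname{gkdim}A=\sup_V\limsup_{n\to\infty}\log_n\dim_k\sum_{i=0}^{n}V^i$ is the Gelfand–Kirillov dimension of a $k$-algebra $A$, the supremum being over all finite-dimensional subspaces $V\subseteq A$. -/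

import Mathlib

open scoped TensorProduct ENNReal

universe u v

noncomputable section

namespace ConnGrHopf

/-- The Gelfand-Kirillov dimension of a `k`-algebra `A`, with values in `[0, ∞]`: the supremum,
over the finite-dimensional subspaces `V` of `A`, of
`limsup_{n → ∞} log_n dim (V ^ 0 + V ^ 1 + ⋯ + V ^ n)`. -/
def gkdim (k A : Type*) [Field k] [Ring A] [Algebra k A] : ℝ≥0∞ :=
  ⨆ (V : Submodule k A) (_ : FiniteDimensional k V),
    Filter.limsup
      (fun n : ℕ => ENNReal.ofReal
        (Real.logb n (Module.finrank k ↥(∑ i ∈ Finset.range (n + 1), V ^ i))))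
      Filter.atTop

section

variable {k H : Type*} [Field k] [Ring H] [HopfAlgebra k H]

/-- For subspaces `M, N` of `H`, the subspace `M ⊗ N` of `H ⊗ H`. -/
def tensorSub (M N : Submodule k H) : Submodule k (H ⊗[k] H) :=
  LinearMap.range (TensorProduct.mapIncl M N)

/-- The degree `n` part `∑_{i + j = n} M_i ⊗ M_j` of `M ⊗ M`, for `M = ⨁ M_i` inside `H`. -/
def tensorDeg (M : ℕ → Submodule k H) (n : ℕ) : Submodule k (H ⊗[k] H) :=
  ⨆ p ∈ Finset.HasAntidiagonal.antidiagonal n, tensorSub (M p.1) (M p.2)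

/-- `(H, 𝒜)` is a connected graded Hopf algebra (that it is a graded algebra is the instance
`GradedAlgebra 𝒜`). -/
structure IsConnectedGradedHopf (𝒜 : ℕ → Submodule k H) [GradedAlgebra 𝒜] : Prop where
  comul_mem : ∀ n, ∀ x ∈ 𝒜 n, Coalgebra.comul (R := k) x ∈ tensorDeg 𝒜 n
  counit_eq_zero : ∀ n, 0 < n → ∀ x ∈ 𝒜 n, Coalgebra.counit (R := k) x = 0
  antipode_mem : ∀ n, ∀ x ∈ 𝒜 n, HopfAlgebra.antipode k x ∈ 𝒜 n
  zero_eq : 𝒜 0 = Submodule.span k {(1 : H)}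

/-- The subalgebra `K` is a graded Hopf subalgebra of `(H, 𝒜)`. -/
structure IsGradedHopfSubalgebra (𝒜 : ℕ → Submodule k H) [GradedAlgebra 𝒜]
    (K : Subalgebra k H) : Prop where
  homogeneous : DirectSum.SetLike.IsHomogeneous 𝒜 K
  comul_mem : ∀ x ∈ K, Coalgebra.comul (R := k) x ∈
    tensorSub (Subalgebra.toSubmodule K) (Subalgebra.toSubmodule K)
  antipode_mem : ∀ x ∈ K, HopfAlgebra.antipode k x ∈ K

/-- `H_+ = ⨁_{n ≥ 1} H_n`. -/
def posPart (𝒜 : ℕ → Submodule k H) : Submodule k H :=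
  ⨆ n : ℕ, ⨆ _ : 1 ≤ n, 𝒜 n

/-- The subalgebra `H^{<γ}` generated by `K` and the `z δ` with `δ < γ`. -/
def subalgLT (K : Subalgebra k H) {Γ : Type*} [LinearOrder Γ] (z : Γ → H) (γ : Γ) :
    Subalgebra k H :=
  Algebra.adjoin k ((K : Set H) ∪ z '' Set.Iio γ)

/-- `(H^{<γ}_+ ⊗ H^{<γ}_+)_n`, where `H^{<γ}_+ = H^{<γ} ∩ H_+`. -/
def tensorLT (𝒜 : ℕ → Submodule k H) (K : Subalgebra k H) {Γ : Type*} [LinearOrder Γ]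
    (z : Γ → H) (γ : Γ) (n : ℕ) : Submodule k (H ⊗[k] H) :=
  tensorDeg (fun i => Subalgebra.toSubmodule (subalgLT K z γ) ⊓ posPart 𝒜 ⊓ 𝒜 i) n

/-- The product `z γ₁ * ⋯ * z γₙ` attached to a nondecreasing finite sequence
`γ₁ ≤ ⋯ ≤ γₙ` (`n ≥ 0`). -/
def orderedMonomial {Γ : Type*} [LinearOrder Γ] (z : Γ → H)
    (w : {l : List Γ // l.Pairwise (· ≤ ·)}) : H :=
  (w.1.map z).prod

end

end ConnGrHopf

end

noncomputable section

namespace ConnGrHopf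

open Coalgebra

set_option linter.unusedSectionVars false

/-! ### Homogeneous components and graded subalgebras -/

section Graded

variable {k H : Type*} [Field k] [Ring H] [Algebra k H]
variable (𝒜 : ℕ → Submodule k H) [GradedAlgebra 𝒜]

/-! The inclusion of `K` in `H` is cut into Ore steps `A < A[z]` between graded sub-bialgebras,
where `z` is homogeneous, primitive modulo `A_+ ⊗ A_+`, and satisfies `[z, A] ⊆ A`. The steps are
found degree by degree. If `A ≤ B` agree up to degree `n`, the reduced coproduct of an element of
`B` of degree `n + 1` has both tensor factors in degrees at most `n`, hence in `A`. Such elements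
can therefore be adjoined to `A` one at a time along a well-order, always giving sub-bialgebras.
When `y` is adjoined to `E`, the commutator with `y` need not preserve `E`, so `E` is first enlarged
to its closure under that commutator. The new elements have degree above `n + 1`, so `y` is still
new and now gives an Ore step. What is left over are jumps invisible up to degree `n + 1`, and the
process repeats (`AgreeUpTo.exists_isJumpSystem`). Ore steps are never refined again, and in the
limit they alone remain (`exists_isJumpSystem_isOreStep`). The resulting order need not be a
well-order, but the steps that contribute in a given degree are well-ordered, which is what the
inductions use.

Independence: for an Ore step there is a functional `φ`, a derivation along the counit, with `φ(A) =
0` and `φ(z) = 1`. Then `D = (id ⊗ φ)Δ` is a derivation on `A[z]` that kills `A` and sends `z` to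
`1`. In characteristic zero, `D^N` isolates the coefficient of the top power `z^N`. Spanning: powers
of `z` are moved to the right at the cost of lower powers, by induction on the degree and then on
the step.

Dimension: over the base field, ordered monomials are a homogeneous basis and counting them gives
the number of steps as the Gelfand-Kirillov dimension (`IsPBWFamily.gkdim_eq_card`). Applying this
to a chain from `k` to `K`, and to that chain followed by the one from `K` to `H`, gives additivity.
-/

theorem proj_mem (n : ℕ) (x : H) : GradedAlgebra.proj 𝒜 n x ∈ 𝒜 n := by
  rw [GradedAlgebra.proj_apply]; exact SetLike.coe_mem _

variable {𝒜}

theorem proj_of_mem {n : ℕ} {x : H} (hx : x ∈ 𝒜 n) : GradedAlgebra.proj 𝒜 n x = x := by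
  rw [GradedAlgebra.proj_apply, DirectSum.decompose_of_mem_same _ hx]

theorem proj_of_mem_ne {m n : ℕ} {x : H} (hx : x ∈ 𝒜 m) (h : m ≠ n) :
    GradedAlgebra.proj 𝒜 n x = 0 := by
  rw [GradedAlgebra.proj_apply, DirectSum.decompose_of_mem_ne _ hx h]

theorem mem_of_proj_mem {M : Submodule k H} {x : H} (h : ∀ n, GradedAlgebra.proj 𝒜 n x ∈ M) :
    x ∈ M := by
  classical
  rw [← DirectSum.sum_support_decompose 𝒜 x]
  exact Submodule.sum_mem _ fun i _ => h i

theorem homogeneous_induction {M : Submodule k H} (hM : ∀ x ∈ M, ∀ n, GradedAlgebra.proj 𝒜 n x ∈ M)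
    {P : H → Prop} (zero : P 0) (hadd : ∀ x y, P x → P y → P (x + y))
    (hom : ∀ n, ∀ x ∈ 𝒜 n, x ∈ M → P x) {x : H} (hx : x ∈ M) : P x := by
  classical
  rw [← DirectSum.sum_support_decompose 𝒜 x]
  exact Finset.sum_induction _ P hadd zero fun i _ => hom i _ (SetLike.coe_mem _) (hM x hx i)

theorem proj_mul (n : ℕ) (x y : H) : GradedAlgebra.proj 𝒜 n (x * y) =
    ∑ p ∈ Finset.HasAntidiagonal.antidiagonal n,
      GradedAlgebra.proj 𝒜 p.1 x * GradedAlgebra.proj 𝒜 p.2 y := by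
  classical
  induction x using DirectSum.Decomposition.inductionOn 𝒜 with
  | zero => simp
  | add a b ha hb => simp only [add_mul, map_add, ha, hb, Finset.sum_add_distrib]
  | homogeneous a =>
    rename_i i
    by_cases h : i ≤ n
    · rw [Finset.sum_eq_single (i, n - i)]
      · rw [proj_of_mem a.2, GradedAlgebra.proj_apply, GradedAlgebra.proj_apply,
          DirectSum.coe_decompose_mul_of_left_mem_of_le 𝒜 a.2 h]
      · rintro ⟨p, q⟩ hp hne
        rw [Finset.HasAntidiagonal.mem_antidiagonal] at hp
        have : i ≠ p := by
          rintro rfl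
          exact hne (by ext <;> simp; simp at hp; omega)
        simp [proj_of_mem_ne a.2 this]
      · intro hn
        exact absurd (Finset.HasAntidiagonal.mem_antidiagonal.2 (by simp; omega)) hn
    · rw [GradedAlgebra.proj_apply, DirectSum.coe_decompose_mul_of_left_mem_of_not_le 𝒜 a.2 h,
        Finset.sum_eq_zero]
      rintro ⟨p, q⟩ hp
      rw [Finset.HasAntidiagonal.mem_antidiagonal] at hp
      have : i ≠ p := by
        rintro rfl
        simp at hp; omega
      simp [proj_of_mem_ne a.2 this]

variable (𝒜) in
/-- The elements whose components of degree at most `N` lie in the subalgebra `E`. -/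
def lowDegreeSubalgebra (E : Subalgebra k H) (N : ℕ) : Subalgebra k H where
  carrier := {x | ∀ m ≤ N, GradedAlgebra.proj 𝒜 m x ∈ E}
  mul_mem' {x y} hx hy m hm := by
    rw [proj_mul]
    refine Subalgebra.sum_mem _ fun p hp => ?_
    have := Finset.HasAntidiagonal.mem_antidiagonal.1 hp
    exact E.mul_mem (hx _ (by omega)) (hy _ (by omega))
  add_mem' {x y} hx hy m hm := by
    rw [map_add]
    exact E.add_mem (hx _ hm) (hy _ hm)
  algebraMap_mem' r m hm := by
    have h0 : algebraMap k H r ∈ 𝒜 0 := SetLike.algebraMap_mem_graded 𝒜 r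
    by_cases h : 0 = m
    · subst h
      rw [proj_of_mem h0]
      exact E.algebraMap_mem r
    · rw [proj_of_mem_ne h0 h]
      exact E.zero_mem

theorem proj_mem_of_isHomogeneous {E : Subalgebra k H} (hE : DirectSum.SetLike.IsHomogeneous 𝒜 E)
    {x : H} (hx : x ∈ E) (n : ℕ) : GradedAlgebra.proj 𝒜 n x ∈ E := by
  rw [GradedAlgebra.proj_apply]; exact hE n hx

/-- Because `lowDegreeSubalgebra` is a subalgebra, this reduces homogeneity of a generated
subalgebra to its generators. -/
theorem isHomogeneous_of_le_lowDegree {E : Subalgebra k H}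
    (h : ∀ N, E ≤ lowDegreeSubalgebra 𝒜 E N) : DirectSum.SetLike.IsHomogeneous 𝒜 E := by
  intro i x hx
  have := h i hx i le_rfl
  rwa [GradedAlgebra.proj_apply] at this

theorem isHomogeneous_adjoin {A : Subalgebra k H} (hA : DirectSum.SetLike.IsHomogeneous 𝒜 A)
    {S : Set H} (hS : ∀ s ∈ S, ∃ n, s ∈ 𝒜 n) :
    DirectSum.SetLike.IsHomogeneous 𝒜 (Algebra.adjoin k ((A : Set H) ∪ S)) := by
  refine isHomogeneous_of_le_lowDegree fun N => Algebra.adjoin_le ?_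
  rintro x (hx | hx) m -
  · exact Algebra.subset_adjoin (Or.inl (proj_mem_of_isHomogeneous hA hx m))
  · obtain ⟨n, hn⟩ := hS x hx
    by_cases h : n = m
    · subst h
      rw [proj_of_mem hn]
      exact Algebra.subset_adjoin (Or.inr hx)
    · rw [proj_of_mem_ne hn h]
      exact Subalgebra.zero_mem _

/-- Adjoining homogeneous elements of degree larger than `N` changes nothing in degree at
most `N`. -/
theorem mem_of_mem_adjoin_of_degree_le {A : Subalgebra k H}
    (hA : DirectSum.SetLike.IsHomogeneous 𝒜 A) {S : Set H} {N : ℕ}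
    (hS : ∀ s ∈ S, s ∈ A ∨ ∃ n, N < n ∧ s ∈ 𝒜 n) {m : ℕ} (hm : m ≤ N) {x : H} (hxm : x ∈ 𝒜 m)
    (hx : x ∈ Algebra.adjoin k ((A : Set H) ∪ S)) : x ∈ A := by
  have h : Algebra.adjoin k ((A : Set H) ∪ S) ≤ lowDegreeSubalgebra 𝒜 A N := by
    refine Algebra.adjoin_le ?_
    have key : ∀ x ∈ A, x ∈ lowDegreeSubalgebra 𝒜 A N :=
      fun x hx m _ => proj_mem_of_isHomogeneous hA hx m
    rintro x (hx | hx)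
    · exact key x hx
    · rcases hS x hx with hx | ⟨n, hn, hxn⟩
      · exact key x hx
      · intro m hm
        rw [proj_of_mem_ne hxn (by omega)]
        exact A.zero_mem
  have := h hx m hm
  rwa [proj_of_mem hxm] at this

theorem le_posPart {n : ℕ} (hn : 0 < n) : 𝒜 n ≤ ⨆ n : ℕ, ⨆ _ : 1 ≤ n, 𝒜 n :=
  le_iSup₂_of_le n hn le_rfl

end Graded

/-! ### Graded sub-bialgebras and the shape of the coproduct -/

section Tensor

variable {k H : Type*} [Field k] [Ring H] [HopfAlgebra k H]

theorem tmul_mem_tensorSub {M N : Submodule k H} {x y : H} (hx : x ∈ M) (hy : y ∈ N) :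
    x ⊗ₜ[k] y ∈ tensorSub M N :=
  ⟨(⟨x, hx⟩ : M) ⊗ₜ (⟨y, hy⟩ : N), by simp [TensorProduct.mapIncl]⟩

theorem tensorSub_le {M N : Submodule k H} {P : Submodule k (H ⊗[k] H)}
    (h : ∀ x ∈ M, ∀ y ∈ N, x ⊗ₜ[k] y ∈ P) : tensorSub M N ≤ P := by
  rintro _ ⟨t, rfl⟩
  induction t with
  | zero => simp
  | add a b ha hb => rw [map_add]; exact P.add_mem ha hb
  | tmul a b => simpa [TensorProduct.mapIncl] using h a a.2 b b.2

theorem tensorSub_mono {M N M' N' : Submodule k H} (hM : M ≤ M') (hN : N ≤ N') :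
    tensorSub M N ≤ tensorSub M' N' :=
  tensorSub_le fun _ hx _ hy => tmul_mem_tensorSub (hM hx) (hN hy)

theorem tmul_mem_tensorDeg {M : ℕ → Submodule k H} {i j n : ℕ} (h : i + j = n) {x y : H}
    (hx : x ∈ M i) (hy : y ∈ M j) : x ⊗ₜ[k] y ∈ tensorDeg M n :=
  Submodule.mem_iSup_of_mem (i, j) (Submodule.mem_iSup_of_mem
    (Finset.HasAntidiagonal.mem_antidiagonal.2 h) (tmul_mem_tensorSub hx hy))

theorem tensorDeg_le {M : ℕ → Submodule k H} {n : ℕ} {P : Submodule k (H ⊗[k] H)}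
    (h : ∀ i j, i + j = n → ∀ x ∈ M i, ∀ y ∈ M j, x ⊗ₜ[k] y ∈ P) : tensorDeg M n ≤ P :=
  iSup₂_le fun p hp => tensorSub_le (h p.1 p.2 (Finset.HasAntidiagonal.mem_antidiagonal.1 hp))

theorem tensorDeg_mono {M M' : ℕ → Submodule k H} (h : ∀ i, M i ≤ M' i) (n : ℕ) :
    tensorDeg M n ≤ tensorDeg M' n :=
  tensorDeg_le fun _ _ hij _ hx _ hy => tmul_mem_tensorDeg hij (h _ hx) (h _ hy)

/-- `C ⊗ C` as a subalgebra of `H ⊗ H`. -/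
def tensorSubalgebra (C : Subalgebra k H) : Subalgebra k (H ⊗[k] H) :=
  (Algebra.TensorProduct.map C.val C.val).range

theorem mem_tensorSubalgebra {C : Subalgebra k H} {t : H ⊗[k] H} :
    t ∈ tensorSubalgebra C ↔
      t ∈ tensorSub (Subalgebra.toSubmodule C) (Subalgebra.toSubmodule C) := Iff.rfl

theorem tmul_mem_tensorSubalgebra {C : Subalgebra k H} {x y : H} (hx : x ∈ C) (hy : y ∈ C) :
    x ⊗ₜ[k] y ∈ tensorSubalgebra C :=
  mem_tensorSubalgebra.2 (tmul_mem_tensorSub hx hy)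

theorem tensorSubalgebra_mono {C C' : Subalgebra k H} (h : C ≤ C') :
    tensorSubalgebra C ≤ tensorSubalgebra C' :=
  fun _ ht => mem_tensorSubalgebra.2 <| tensorSub_mono (Subalgebra.toSubmodule.monotone h)
    (Subalgebra.toSubmodule.monotone h) (mem_tensorSubalgebra.1 ht)

variable (𝒜 : ℕ → Submodule k H) [GradedAlgebra 𝒜]

/-- The projection of `H ⊗ H` to its part of total degree `n`. -/
def tensorProj (n : ℕ) : H ⊗[k] H →ₗ[k] H ⊗[k] H :=
  ∑ p ∈ Finset.HasAntidiagonal.antidiagonal n,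
    TensorProduct.map (GradedAlgebra.proj 𝒜 p.1) (GradedAlgebra.proj 𝒜 p.2)

variable {𝒜}

theorem tensorProj_of_mem {n : ℕ} {t : H ⊗[k] H} (ht : t ∈ tensorDeg 𝒜 n) :
    tensorProj 𝒜 n t = t := by
  suffices h : tensorDeg 𝒜 n ≤ LinearMap.eqLocus (tensorProj 𝒜 n) LinearMap.id from h ht
  refine tensorDeg_le fun i j hij x hx y hy => ?_
  rw [LinearMap.mem_eqLocus, tensorProj, LinearMap.sum_apply, Finset.sum_eq_single (i, j)]
  · simp [proj_of_mem hx, proj_of_mem hy]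
  · rintro ⟨p, q⟩ hp hne
    rw [Finset.HasAntidiagonal.mem_antidiagonal] at hp
    have : i ≠ p := by
      rintro rfl
      exact hne (by ext <;> simp; simp at hp; omega)
    simp [proj_of_mem_ne hx this]
  · intro hn
    exact absurd (Finset.HasAntidiagonal.mem_antidiagonal.2 hij) hn

variable (𝒜) in
/-- A homogeneous subalgebra stable under the comultiplication. -/
structure IsGradedSubbialgebra (A : Subalgebra k H) : Prop where
  homogeneous : DirectSum.SetLike.IsHomogeneous 𝒜 A
  comul_mem : ∀ x ∈ A, comul (R := k) x ∈ tensorSubalgebra A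

theorem IsGradedSubbialgebra.proj_mem {A : Subalgebra k H} (hA : IsGradedSubbialgebra 𝒜 A)
    {x : H} (hx : x ∈ A) (n : ℕ) : GradedAlgebra.proj 𝒜 n x ∈ A :=
  proj_mem_of_isHomogeneous hA.homogeneous hx n

/-- The comultiplication is an algebra map, so the preimage of a tensor square of subalgebras is a
subalgebra and only generators need checking. -/
theorem IsGradedSubbialgebra.adjoin {A : Subalgebra k H} (hA : IsGradedSubbialgebra 𝒜 A)
    {S : Set H} (hS : ∀ s ∈ S, ∃ n, s ∈ 𝒜 n)
    (hΔ : ∀ s ∈ S, comul (R := k) s ∈ tensorSubalgebra (Algebra.adjoin k ((A : Set H) ∪ S))) :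
    IsGradedSubbialgebra 𝒜 (Algebra.adjoin k ((A : Set H) ∪ S)) where
  homogeneous := isHomogeneous_adjoin hA.homogeneous hS
  comul_mem := by
    suffices h : Algebra.adjoin k ((A : Set H) ∪ S) ≤
        (tensorSubalgebra (Algebra.adjoin k ((A : Set H) ∪ S))).comap (Bialgebra.comulAlgHom k H)
      from fun x hx => h hx
    refine Algebra.adjoin_le ?_
    rintro x (hx | hx)
    · exact tensorSubalgebra_mono (fun y hy => Algebra.subset_adjoin (Or.inl hy))
        (hA.comul_mem x hx)
    · exact hΔ x hx

/-- The projection to total degree `n` fixes the coproduct of `x` and, since `A` is homogeneous,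
maps `A ⊗ A` into the sum of the `A_i ⊗ A_j` with `i + j = n`. -/
theorem IsGradedSubbialgebra.comul_mem_tensorDeg (hH : IsConnectedGradedHopf 𝒜)
    {A : Subalgebra k H} (hA : IsGradedSubbialgebra 𝒜 A) {n : ℕ} {x : H} (hxn : x ∈ 𝒜 n)
    (hx : x ∈ A) :
    comul (R := k) x ∈ tensorDeg (fun i => Subalgebra.toSubmodule A ⊓ 𝒜 i) n := by
  rw [← tensorProj_of_mem (hH.comul_mem n x hxn)]
  suffices h : tensorSub (Subalgebra.toSubmodule A) (Subalgebra.toSubmodule A) ≤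
      (tensorDeg (fun i => Subalgebra.toSubmodule A ⊓ 𝒜 i) n).comap (tensorProj 𝒜 n) from
    h (hA.comul_mem x hx)
  refine tensorSub_le fun a ha b hb => ?_
  rw [Submodule.mem_comap, tensorProj, LinearMap.sum_apply]
  refine Submodule.sum_mem _ fun p hp => ?_
  rw [TensorProduct.map_tmul]
  exact tmul_mem_tensorDeg (Finset.HasAntidiagonal.mem_antidiagonal.1 hp)
    ⟨hA.proj_mem ha _, ConnGrHopf.proj_mem _ _ _⟩ ⟨hA.proj_mem hb _, ConnGrHopf.proj_mem _ _ _⟩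

/-- The homogeneous parts `A_+ ∩ H_i` of the augmentation ideal of a subalgebra `A`. -/
abbrev augPart (𝒜 : ℕ → Submodule k H) (A : Subalgebra k H) (i : ℕ) : Submodule k H :=
  Subalgebra.toSubmodule A ⊓ posPart 𝒜 ⊓ 𝒜 i

theorem counit_eq_zero_of_mem_posPart (hH : IsConnectedGradedHopf 𝒜) {x : H}
    (hx : x ∈ posPart 𝒜) : counit (R := k) x = 0 := by
  suffices h : posPart 𝒜 ≤ LinearMap.ker (counit (R := k) (A := H)) from h hx
  exact iSup₂_le fun n hn x hx => hH.counit_eq_zero n hn x hx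

theorem mem_augPart {A : Subalgebra k H} {n : ℕ} (hn : 0 < n) {x : H} (hxn : x ∈ 𝒜 n)
    (hx : x ∈ A) : x ∈ augPart 𝒜 A n :=
  ⟨⟨hx, le_posPart hn hxn⟩, hxn⟩

theorem exists_smul_one (hH : IsConnectedGradedHopf 𝒜) {x : H} (hx : x ∈ 𝒜 0) :
    ∃ c : k, x = c • (1 : H) := by
  rw [hH.zero_eq, Submodule.mem_span_singleton] at hx
  obtain ⟨c, rfl⟩ := hx
  exact ⟨c, rfl⟩

/-- By connectedness the terms of bidegree `(0, n)` and `(n, 0)` are `1 ⊗ u` and `v ⊗ 1`. The counit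
kills the remaining terms on either side, so the two counit axioms force `u = v = x`. -/
theorem IsGradedSubbialgebra.exists_comul_eq (hH : IsConnectedGradedHopf 𝒜)
    {A : Subalgebra k H} (hA : IsGradedSubbialgebra 𝒜 A) {n : ℕ} (hn : 0 < n) {x : H}
    (hxn : x ∈ 𝒜 n) (hx : x ∈ A) :
    ∃ t ∈ tensorDeg (augPart 𝒜 A) n,
      comul (R := k) x = 1 ⊗ₜ[k] x + x ⊗ₜ[k] 1 + t := by
  have key : ∃ u ∈ 𝒜 n, ∃ v ∈ 𝒜 n, ∃ t ∈ tensorDeg (augPart 𝒜 A) n,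
      comul (R := k) x = 1 ⊗ₜ[k] u + v ⊗ₜ[k] 1 + t := by
    have h1 : tensorDeg (fun i => Subalgebra.toSubmodule A ⊓ 𝒜 i) n ≤
        (𝒜 n).map (TensorProduct.mk k H H 1) ⊔
          (𝒜 n).map ((TensorProduct.mk k H H).flip 1) ⊔ tensorDeg (augPart 𝒜 A) n := by
      refine tensorDeg_le fun i j hij a ha b hb => ?_
      rcases Nat.eq_zero_or_pos i with rfl | hi
      · obtain ⟨c, rfl⟩ := exists_smul_one hH ha.2
        obtain rfl : j = n := by omega
        refine Submodule.mem_sup_left (Submodule.mem_sup_left ⟨c • b, ?_, ?_⟩)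
        · exact Submodule.smul_mem _ _ hb.2
        · simp [TensorProduct.smul_tmul]
      rcases Nat.eq_zero_or_pos j with rfl | hj
      · obtain ⟨c, rfl⟩ := exists_smul_one hH hb.2
        obtain rfl : i = n := by omega
        refine Submodule.mem_sup_left (Submodule.mem_sup_right ⟨c • a, ?_, ?_⟩)
        · exact Submodule.smul_mem _ _ ha.2
        · simp
      · exact Submodule.mem_sup_right (tmul_mem_tensorDeg hij (mem_augPart hi ha.2 ha.1)
          (mem_augPart hj hb.2 hb.1))
    obtain ⟨y, hy, t, ht, hyt⟩ := Submodule.mem_sup.1 (h1 (hA.comul_mem_tensorDeg hH hxn hx))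
    obtain ⟨_, ⟨u, hu, rfl⟩, _, ⟨v, hv, rfl⟩, rfl⟩ := Submodule.mem_sup.1 hy
    exact ⟨u, hu, v, hv, t, ht, hyt.symm⟩
  obtain ⟨u, hu, v, hv, t, ht, hx'⟩ := key
  have hl : TensorProduct.lid k H (counit.rTensor H t) = 0 := by
    suffices h : tensorDeg (augPart 𝒜 A) n ≤ LinearMap.ker
        ((TensorProduct.lid k H).toLinearMap ∘ₗ (counit (R := k) (A := H)).rTensor H) from h ht
    refine tensorDeg_le fun i j hij a ha b hb => ?_
    simp [counit_eq_zero_of_mem_posPart hH ha.1.2]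
  have hr : TensorProduct.rid k H (counit.lTensor H t) = 0 := by
    suffices h : tensorDeg (augPart 𝒜 A) n ≤ LinearMap.ker
        ((TensorProduct.rid k H).toLinearMap ∘ₗ (counit (R := k) (A := H)).lTensor H) from h ht
    refine tensorDeg_le fun i j hij a ha b hb => ?_
    simp [counit_eq_zero_of_mem_posPart hH hb.1.2]
  have e1 : x = u := by
    have := congrArg (TensorProduct.lid k H) (Coalgebra.rTensor_counit_comul (R := k) x)
    rw [hx', map_add, map_add, map_add, map_add, hl] at this
    simpa [hH.counit_eq_zero n hn v hv] using this.symm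
  have e2 : x = v := by
    have := congrArg (TensorProduct.rid k H) (Coalgebra.lTensor_counit_comul (R := k) x)
    rw [hx', map_add, map_add, map_add, map_add, hr] at this
    simpa [hH.counit_eq_zero n hn u hu] using this.symm
  exact ⟨t, ht, by rw [hx', ← e1, ← e2]⟩

theorem tensorDeg_augPart_mono {A B : Subalgebra k H} (h : A ≤ B) (n : ℕ) :
    tensorDeg (augPart 𝒜 A) n ≤ tensorDeg (augPart 𝒜 B) n :=
  tensorDeg_mono (fun _ => inf_le_inf_right _ (inf_le_inf_right _ h)) n

theorem tensorDeg_augPart_le (A : Subalgebra k H) (n : ℕ) :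
    tensorDeg (augPart 𝒜 A) n ≤ Subalgebra.toSubmodule (tensorSubalgebra A) :=
  tensorDeg_le fun _ _ _ _ hx _ hy => tmul_mem_tensorSubalgebra hx.1.1 hy.1.1

end Tensor

end ConnGrHopf

namespace ConnGrHopf

open Coalgebra

set_option linter.unusedSectionVars false

/-! ### Closure under a commutator, and Ore steps -/

variable {k H : Type*} [Field k] [Ring H] [HopfAlgebra k H]

/-- The commutator with `z`. -/
def commWith (z : H) (a : H) : H := z * a - a * z

/-- The iterated commutators with `z` of the homogeneous elements of `E`. -/
def iteratedComms (𝒜 : ℕ → Submodule k H) (E : Subalgebra k H) (z : H) : Set H :=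
  {x | ∃ i m a, a ∈ E ∧ a ∈ 𝒜 m ∧ x = (commWith z)^[i] a}

/-- The smallest subalgebra containing `E` that is stable under the commutator with `z`. -/
def commClosure (𝒜 : ℕ → Submodule k H) (E : Subalgebra k H) (z : H) : Subalgebra k H :=
  Algebra.adjoin k ((E : Set H) ∪ iteratedComms 𝒜 E z)

variable {𝒜 : ℕ → Submodule k H} [GradedAlgebra 𝒜]

theorem commWith_mem_graded {d m : ℕ} {z a : H} (hz : z ∈ 𝒜 d) (ha : a ∈ 𝒜 m) :
    commWith z a ∈ 𝒜 (m + d) := by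
  refine Submodule.sub_mem _ ?_ (SetLike.mul_mem_graded ha hz)
  rw [add_comm]
  exact SetLike.mul_mem_graded hz ha

theorem iterate_commWith_mem_graded {d m : ℕ} {z a : H} (hz : z ∈ 𝒜 d) (ha : a ∈ 𝒜 m) (i : ℕ) :
    (commWith z)^[i] a ∈ 𝒜 (m + i * d) := by
  induction i with
  | zero => simpa using ha
  | succ i ih =>
    rw [Function.iterate_succ_apply']
    have := commWith_mem_graded hz ih
    rwa [add_assoc, ← Nat.succ_mul] at this

theorem commWith_add (z x y : H) : commWith z (x + y) = commWith z x + commWith z y := by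
  simp only [commWith]; noncomm_ring

theorem commWith_mul (z x y : H) : commWith z (x * y) = commWith z x * y + x * commWith z y := by
  simp only [commWith]; noncomm_ring

theorem commWith_algebraMap (z : H) (c : k) : commWith z (algebraMap k H c) = 0 := by
  simp only [commWith]
  rw [Algebra.commutes, sub_self]

theorem iterate_commWith_zero (z : H) (i : ℕ) : (commWith z)^[i] 0 = 0 :=
  Function.iterate_fixed (by simp [commWith]) i

theorem le_commClosure (E : Subalgebra k H) (z : H) : E ≤ commClosure 𝒜 E z :=
  fun _ hx => Algebra.subset_adjoin (Or.inl hx)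

/-- The commutator is a derivation, so generators suffice; general elements of `E` are split into
components because `iteratedComms` starts from homogeneous ones. -/
theorem commWith_mem_commClosure {E : Subalgebra k H} (hE : DirectSum.SetLike.IsHomogeneous 𝒜 E)
    {z a : H} (ha : a ∈ commClosure 𝒜 E z) : commWith z a ∈ commClosure 𝒜 E z := by
  induction ha using Algebra.adjoin_induction with
  | mem x hx =>
    rcases hx with hx | ⟨i, m, a, ha, ham, rfl⟩
    · refine homogeneous_induction (𝒜 := 𝒜) (M := Subalgebra.toSubmodule E)
        (fun x hx n => proj_mem_of_isHomogeneous hE hx n)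
        (P := fun y => commWith z y ∈ commClosure 𝒜 E z) ?_ ?_ ?_ hx
      · simp [commWith]
      · intro x y hx hy
        rw [commWith_add]
        exact add_mem hx hy
      · intro n x hxn hx
        exact Algebra.subset_adjoin (Or.inr ⟨1, n, x, hx, hxn, rfl⟩)
    · refine Algebra.subset_adjoin (Or.inr ⟨i + 1, m, a, ha, ham, ?_⟩)
      rw [Function.iterate_succ_apply']
  | algebraMap r =>
    rw [commWith_algebraMap]
    exact zero_mem _
  | add x y _ _ hx hy =>
    rw [commWith_add]
    exact add_mem hx hy
  | mul x y hx' hy' hx hy =>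
    rw [commWith_mul]
    exact add_mem (mul_mem hx hy') (mul_mem hx' hy)

/-- A commutator iterated at least once vanishes on scalars, and on elements of positive degree it
lands in degree greater than `d`. -/
theorem commClosure_agrees (hH : IsConnectedGradedHopf 𝒜) {E : Subalgebra k H}
    (hE : DirectSum.SetLike.IsHomogeneous 𝒜 E) {d : ℕ} {z : H} (hz : z ∈ 𝒜 d)
    {m : ℕ} (hm : m ≤ d) {x : H} (hxm : x ∈ 𝒜 m) (hx : x ∈ commClosure 𝒜 E z) : x ∈ E := by
  refine mem_of_mem_adjoin_of_degree_le hE ?_ hm hxm hx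
  rintro _ ⟨i, l, a, ha, hal, rfl⟩
  rcases i with _ | i
  · exact Or.inl ha
  rcases Nat.eq_zero_or_pos l with rfl | hl
  · left
    obtain ⟨c, rfl⟩ := exists_smul_one hH hal
    rw [Function.iterate_succ_apply, ← Algebra.algebraMap_eq_smul_one, commWith_algebraMap,
      iterate_commWith_zero]
    exact zero_mem _
  · right
    refine ⟨_, ?_, iterate_commWith_mem_graded hz hal (i + 1)⟩
    have : d ≤ (i + 1) * d := Nat.le_mul_of_pos_left d (Nat.succ_pos i)
    omega

/-- Commutation with `1 ⊗ z + z ⊗ 1` sends `a ⊗ b` to `a ⊗ [z, b] + [z, a] ⊗ b`, and commutation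
with `t` takes place inside the algebra `C ⊗ C`. -/
theorem commWith_comul_mem {C : Subalgebra k H} {z : H} (hz : ∀ a ∈ C, commWith z a ∈ C)
    {t : H ⊗[k] H} (ht : t ∈ tensorSubalgebra C)
    (hΔ : comul (R := k) z = 1 ⊗ₜ[k] z + z ⊗ₜ[k] 1 + t) {u : H ⊗[k] H}
    (hu : u ∈ tensorSubalgebra C) :
    comul (R := k) z * u - u * comul (R := k) z ∈ tensorSubalgebra C := by
  have h1 : (1 ⊗ₜ[k] z + z ⊗ₜ[k] 1) * u - u * (1 ⊗ₜ[k] z + z ⊗ₜ[k] 1) ∈ tensorSubalgebra C := by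
    suffices h : tensorSub (Subalgebra.toSubmodule C) (Subalgebra.toSubmodule C) ≤
        (Subalgebra.toSubmodule (tensorSubalgebra C)).comap
          (LinearMap.mulLeft k (1 ⊗ₜ[k] z + z ⊗ₜ[k] 1) -
            LinearMap.mulRight k (1 ⊗ₜ[k] z + z ⊗ₜ[k] 1)) from h hu
    refine tensorSub_le fun a ha b hb => ?_
    have e : (1 ⊗ₜ[k] z + z ⊗ₜ[k] 1) * (a ⊗ₜ[k] b) - (a ⊗ₜ[k] b) * (1 ⊗ₜ[k] z + z ⊗ₜ[k] 1) =
        a ⊗ₜ[k] commWith z b + commWith z a ⊗ₜ[k] b := by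
      simp only [commWith, add_mul, mul_add, Algebra.TensorProduct.tmul_mul_tmul, one_mul, mul_one,
        TensorProduct.tmul_sub, TensorProduct.sub_tmul]
      abel
    change (1 ⊗ₜ[k] z + z ⊗ₜ[k] 1) * (a ⊗ₜ[k] b) - (a ⊗ₜ[k] b) * (1 ⊗ₜ[k] z + z ⊗ₜ[k] 1) ∈
      tensorSubalgebra C
    rw [e]
    exact add_mem (tmul_mem_tensorSubalgebra ha (hz b hb))
      (tmul_mem_tensorSubalgebra (hz a ha) hb)
  have e : comul (R := k) z * u - u * comul (R := k) z =
      ((1 ⊗ₜ[k] z + z ⊗ₜ[k] 1) * u - u * (1 ⊗ₜ[k] z + z ⊗ₜ[k] 1)) + (t * u - u * t) := by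
    rw [hΔ]; noncomm_ring
  rw [e]
  exact add_mem h1 (sub_mem (mul_mem ht hu) (mul_mem hu ht))

theorem IsGradedSubbialgebra.commClosure {E : Subalgebra k H} (hE : IsGradedSubbialgebra 𝒜 E)
    {d : ℕ} {z : H} (hz : z ∈ 𝒜 d) {t : H ⊗[k] H} (ht : t ∈ tensorSubalgebra E)
    (hΔ : comul (R := k) z = 1 ⊗ₜ[k] z + z ⊗ₜ[k] 1 + t) :
    IsGradedSubbialgebra 𝒜 (commClosure 𝒜 E z) := by
  refine hE.adjoin ?_ ?_
  · rintro _ ⟨i, m, a, ha, ham, rfl⟩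
    exact ⟨_, iterate_commWith_mem_graded hz ham i⟩
  · rintro _ ⟨i, m, a, ha, ham, rfl⟩
    change _ ∈ tensorSubalgebra (ConnGrHopf.commClosure 𝒜 E z)
    have hle := tensorSubalgebra_mono (le_commClosure (𝒜 := 𝒜) E z)
    induction i with
    | zero => exact hle (hE.comul_mem a ha)
    | succ i ih =>
      rw [Function.iterate_succ_apply']
      have := commWith_comul_mem (fun a ha => commWith_mem_commClosure hE.homogeneous ha)
        (hle ht) hΔ ih
      rwa [← Bialgebra.comul_mul, ← Bialgebra.comul_mul, ← map_sub] at this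

variable (𝒜) in
/-- `B` is obtained from `A` by adjoining the homogeneous element `z` of degree `d`, which is
primitive modulo `A` and normalizes `A`. -/
structure IsOreStep (A B : Subalgebra k H) (z : H) (d : ℕ) : Prop where
  pos : 0 < d
  mem_graded : z ∈ 𝒜 d
  notMem : z ∉ A
  comul_eq : ∃ t ∈ tensorDeg (augPart 𝒜 A) d, comul (R := k) z = 1 ⊗ₜ[k] z + z ⊗ₜ[k] 1 + t
  commWith_mem : ∀ a ∈ A, commWith z a ∈ A
  eq_adjoin : B = Algebra.adjoin k ((A : Set H) ∪ {z})

theorem IsOreStep.le {A B : Subalgebra k H} {z : H} {d : ℕ} (h : IsOreStep 𝒜 A B z d) : A ≤ B := by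
  rw [h.eq_adjoin]
  exact fun _ hx => Algebra.subset_adjoin (Or.inl hx)

theorem IsOreStep.mem {A B : Subalgebra k H} {z : H} {d : ℕ} (h : IsOreStep 𝒜 A B z d) :
    z ∈ B := by
  rw [h.eq_adjoin]
  exact Algebra.subset_adjoin (Or.inr rfl)

theorem iterate_commWith_mem {C : Subalgebra k H} {z a : H} (hz : z ∈ C) (ha : a ∈ C) (i : ℕ) :
    (commWith z)^[i] a ∈ C := by
  induction i with
  | zero => exact ha
  | succ i ih =>
    rw [Function.iterate_succ_apply']
    exact sub_mem (mul_mem hz ih) (mul_mem ih hz)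

theorem commClosure_le {C E : Subalgebra k H} {z : H} (hE : E ≤ C) (hz : z ∈ C) :
    commClosure 𝒜 E z ≤ C := by
  refine Algebra.adjoin_le ?_
  rintro _ (hx | ⟨i, m, a, ha, -, rfl⟩)
  · exact hE hx
  · exact iterate_commWith_mem hz (hE ha) i

/-- The closure supplies the missing normalization. It gains nothing in degree `d`, so `z` stays
outside it, and it lies inside `E[z]`, so adjoining `z` still gives `F`. -/
theorem isOreStep_commClosure (hH : IsConnectedGradedHopf 𝒜) {E F : Subalgebra k H}
    (hE : IsGradedSubbialgebra 𝒜 E) {d : ℕ} (hd : 0 < d) {z : H} (hz : z ∈ 𝒜 d) (hzE : z ∉ E)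
    (hΔ : ∃ t ∈ tensorDeg (augPart 𝒜 E) d, comul (R := k) z = 1 ⊗ₜ[k] z + z ⊗ₜ[k] 1 + t)
    (hF : F = Algebra.adjoin k ((E : Set H) ∪ {z})) :
    IsOreStep 𝒜 (commClosure 𝒜 E z) F z d where
  pos := hd
  mem_graded := hz
  notMem h := hzE (commClosure_agrees hH hE.homogeneous hz le_rfl hz h)
  comul_eq := by
    obtain ⟨t, ht, e⟩ := hΔ
    exact ⟨t, tensorDeg_augPart_mono (le_commClosure E z) d ht, e⟩
  commWith_mem a ha := commWith_mem_commClosure hE.homogeneous ha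
  eq_adjoin := by
    have hEF : E ≤ F := by
      rw [hF]
      exact fun _ h => Algebra.subset_adjoin (Or.inl h)
    have hzF : z ∈ F := by
      rw [hF]
      exact Algebra.subset_adjoin (Or.inr rfl)
    refine le_antisymm ?_ (Algebra.adjoin_le (Set.union_subset (commClosure_le (𝒜 := 𝒜) hEF hzF)
      (Set.singleton_subset_iff.2 hzF)))
    rw [hF]
    exact Algebra.adjoin_mono (Set.union_subset_union_left _ (le_commClosure (𝒜 := 𝒜) E z))

/-! ### Systems of jumps -/

variable (𝒜) in
/-- The jump `j` from `j.1` to `j.2` is visible in degree `n`. -/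
def IsActive (n : ℕ) (j : Subalgebra k H × Subalgebra k H) : Prop :=
  ∃ x ∈ 𝒜 n, x ∈ j.2 ∧ x ∉ j.1

variable (𝒜) in
/-- A totally ordered set of jumps between graded sub-bialgebras that leads from `A₀` to `B₀` and
that is well-ordered in each degree. -/
structure IsJumpSystem (A₀ B₀ : Subalgebra k H) (J : Set (Subalgebra k H × Subalgebra k H)) :
    Prop where
  left : ∀ j ∈ J, IsGradedSubbialgebra 𝒜 j.1
  right : ∀ j ∈ J, IsGradedSubbialgebra 𝒜 j.2
  le_left : ∀ j ∈ J, A₀ ≤ j.1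
  lt : ∀ j ∈ J, j.1 < j.2
  right_le : ∀ j ∈ J, j.2 ≤ B₀
  separated : ∀ i ∈ J, ∀ j ∈ J, i = j ∨ i.2 ≤ j.1 ∨ j.2 ≤ i.1
  cover : ∀ n, ∀ x ∈ 𝒜 n, x ∈ B₀ → x ∉ A₀ → ∃ j ∈ J, x ∈ j.2 ∧ x ∉ j.1
  exists_least : ∀ n, ∀ S ⊆ J, S.Nonempty → (∀ j ∈ S, IsActive 𝒜 n j) →
    ∃ m ∈ S, ∀ j ∈ S, m.1 ≤ j.1

theorem isJumpSystem_single {A B : Subalgebra k H} (hA : IsGradedSubbialgebra 𝒜 A)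
    (hB : IsGradedSubbialgebra 𝒜 B) (h : A ≤ B) :
    IsJumpSystem 𝒜 A B {j | j = (A, B) ∧ A < B} where
  left := by rintro _ ⟨rfl, -⟩; exact hA
  right := by rintro _ ⟨rfl, -⟩; exact hB
  le_left := by rintro _ ⟨rfl, -⟩; exact le_rfl
  lt := by rintro _ ⟨rfl, h⟩; exact h
  right_le := by rintro _ ⟨rfl, -⟩; exact le_rfl
  separated := by rintro _ ⟨rfl, -⟩ _ ⟨rfl, -⟩; exact Or.inl rfl
  cover n x _ hx hx' := ⟨(A, B), ⟨rfl, lt_of_le_not_ge h fun h' => hx' (h' hx)⟩, hx, hx'⟩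
  exists_least := by
    rintro n S hS ⟨m, hm⟩ -
    refine ⟨m, hm, fun j hj => ?_⟩
    rw [(hS hm).1, (hS hj).1]

theorem IsJumpSystem.append {A C B : Subalgebra k H}
    {J J' : Set (Subalgebra k H × Subalgebra k H)} (hJ : IsJumpSystem 𝒜 A C J)
    (hJ' : IsJumpSystem 𝒜 C B J') (hAC : A ≤ C) (hCB : C ≤ B) :
    IsJumpSystem 𝒜 A B (J ∪ J') where
  left := by rintro j (hj | hj); exacts [hJ.left j hj, hJ'.left j hj]
  right := by rintro j (hj | hj); exacts [hJ.right j hj, hJ'.right j hj]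
  le_left := by rintro j (hj | hj); exacts [hJ.le_left j hj, hAC.trans (hJ'.le_left j hj)]
  lt := by rintro j (hj | hj); exacts [hJ.lt j hj, hJ'.lt j hj]
  right_le := by rintro j (hj | hj); exacts [(hJ.right_le j hj).trans hCB, hJ'.right_le j hj]
  separated := by
    rintro i (hi | hi) j (hj | hj)
    · exact hJ.separated i hi j hj
    · exact Or.inr (Or.inl ((hJ.right_le i hi).trans (hJ'.le_left j hj)))
    · exact Or.inr (Or.inr ((hJ.right_le j hj).trans (hJ'.le_left i hi)))
    · exact hJ'.separated i hi j hj
  cover n x hxn hxB hxA := by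
    by_cases hxC : x ∈ C
    · obtain ⟨j, hj, h⟩ := hJ.cover n x hxn hxC hxA
      exact ⟨j, Or.inl hj, h⟩
    · obtain ⟨j, hj, h⟩ := hJ'.cover n x hxn hxB hxC
      exact ⟨j, Or.inr hj, h⟩
  exists_least n S hS hne hact := by
    by_cases h : (S ∩ J).Nonempty
    · obtain ⟨m, hm, hle⟩ := hJ.exists_least n (S ∩ J) Set.inter_subset_right h
        fun j hj => hact j hj.1
      refine ⟨m, hm.1, fun j hj => ?_⟩
      rcases hS hj with hj' | hj'
      · exact hle j ⟨hj, hj'⟩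
      · exact (hJ.lt m hm.2).le.trans ((hJ.right_le m hm.2).trans (hJ'.le_left j hj'))
    · exact hJ'.exists_least n S (fun j hj => (hS hj).resolve_left fun h' => h ⟨j, hj, h'⟩) hne hact

/-- Refining each jump of a system by a system gives a system. -/
theorem IsJumpSystem.biUnion {A B : Subalgebra k H} {J : Set (Subalgebra k H × Subalgebra k H)}
    (hJ : IsJumpSystem 𝒜 A B J)
    {R : Subalgebra k H × Subalgebra k H → Set (Subalgebra k H × Subalgebra k H)}
    (hR : ∀ j ∈ J, IsJumpSystem 𝒜 j.1 j.2 (R j)) : IsJumpSystem 𝒜 A B (⋃ j ∈ J, R j) where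
  left i hi := by
    obtain ⟨j, hj, hi⟩ := Set.mem_iUnion₂.1 hi
    exact (hR j hj).left i hi
  right i hi := by
    obtain ⟨j, hj, hi⟩ := Set.mem_iUnion₂.1 hi
    exact (hR j hj).right i hi
  le_left i hi := by
    obtain ⟨j, hj, hi⟩ := Set.mem_iUnion₂.1 hi
    exact (hJ.le_left j hj).trans ((hR j hj).le_left i hi)
  lt i hi := by
    obtain ⟨j, hj, hi⟩ := Set.mem_iUnion₂.1 hi
    exact (hR j hj).lt i hi
  right_le i hi := by
    obtain ⟨j, hj, hi⟩ := Set.mem_iUnion₂.1 hi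
    exact ((hR j hj).right_le i hi).trans (hJ.right_le j hj)
  separated i hi i' hi' := by
    obtain ⟨j, hj, hi⟩ := Set.mem_iUnion₂.1 hi
    obtain ⟨j', hj', hi'⟩ := Set.mem_iUnion₂.1 hi'
    rcases hJ.separated j hj j' hj' with rfl | h | h
    · exact (hR j hj).separated i hi i' hi'
    · exact Or.inr (Or.inl (((hR j hj).right_le i hi).trans
        (h.trans ((hR j' hj').le_left i' hi'))))
    · exact Or.inr (Or.inr (((hR j' hj').right_le i' hi').trans
        (h.trans ((hR j hj).le_left i hi))))
  cover n x hxn hxB hxA := by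
    obtain ⟨j, hj, h2, h1⟩ := hJ.cover n x hxn hxB hxA
    obtain ⟨i, hi, h⟩ := (hR j hj).cover n x hxn h2 h1
    exact ⟨i, Set.mem_iUnion₂.2 ⟨j, hj, hi⟩, h⟩
  exists_least n S hS hne hact := by
    -- Lexicographic choice: first the least outer jump whose refinement meets `S`, then the least
    -- inner one. An outer jump containing an active inner jump is itself active.
    obtain ⟨m, ⟨hm, hSm⟩, hle⟩ := hJ.exists_least n {j | j ∈ J ∧ (S ∩ R j).Nonempty}
      (fun j hj => hj.1)
      (by
        obtain ⟨s, hs⟩ := hne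
        obtain ⟨j, hj, hi⟩ := Set.mem_iUnion₂.1 (hS hs)
        exact ⟨j, hj, s, hs, hi⟩)
      (by
        rintro j ⟨hj, s, hs, hsj⟩
        obtain ⟨x, hxn, h2, h1⟩ := hact s hs
        exact ⟨x, hxn, (hR j hj).right_le s hsj h2, fun h => h1 ((hR j hj).le_left s hsj h)⟩)
    obtain ⟨s, hs, hles⟩ := (hR m hm).exists_least n (S ∩ R m) Set.inter_subset_right hSm
      fun j hj => hact j hj.1
    refine ⟨s, hs.1, fun i hi => ?_⟩
    obtain ⟨j, hj, hij⟩ := Set.mem_iUnion₂.1 (hS hi)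
    rcases hJ.separated m hm j hj with rfl | h | h
    · exact hles i ⟨hi, hij⟩
    · exact ((hR m hm).lt s hs.2).le.trans (((hR m hm).right_le s hs.2).trans
        (h.trans ((hR j hj).le_left i hij)))
    · exact absurd ((hJ.lt j hj).trans_le (h.trans (hle j ⟨hj, i, hi, hij⟩))) (lt_irrefl _)

/-- An element involves only finitely many generators, and the largest of them serves as the bound.
-/
theorem mem_adjoin_Iic [LinearOrder H] {A : Subalgebra k H} {X : Set H} {x : H}
    (hx : x ∈ Algebra.adjoin k ((A : Set H) ∪ X)) :
    x ∈ A ∨ ∃ y ∈ X, x ∈ Algebra.adjoin k ((A : Set H) ∪ (X ∩ Set.Iic y)) := by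
  have mono : ∀ {y y' : H}, y ≤ y' → Algebra.adjoin k ((A : Set H) ∪ (X ∩ Set.Iic y)) ≤
      Algebra.adjoin k ((A : Set H) ∪ (X ∩ Set.Iic y')) := fun h =>
    Algebra.adjoin_mono (Set.union_subset_union_right _
      (Set.inter_subset_inter_right _ (Set.Iic_subset_Iic.2 h)))
  have hA : ∀ y : H, A ≤ Algebra.adjoin k ((A : Set H) ∪ (X ∩ Set.Iic y)) :=
    fun y z hz => Algebra.subset_adjoin (Or.inl hz)
  have common : ∀ {a b : H},
      (a ∈ A ∨ ∃ y ∈ X, a ∈ Algebra.adjoin k ((A : Set H) ∪ (X ∩ Set.Iic y))) →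
      (b ∈ A ∨ ∃ y ∈ X, b ∈ Algebra.adjoin k ((A : Set H) ∪ (X ∩ Set.Iic y))) →
      (a ∈ A ∧ b ∈ A) ∨ ∃ y ∈ X, a ∈ Algebra.adjoin k ((A : Set H) ∪ (X ∩ Set.Iic y)) ∧
        b ∈ Algebra.adjoin k ((A : Set H) ∪ (X ∩ Set.Iic y)) := by
    rintro a b (ha | ⟨y, hy, ha⟩) (hb | ⟨y', hy', hb⟩)
    · exact Or.inl ⟨ha, hb⟩
    · exact Or.inr ⟨y', hy', hA _ ha, hb⟩
    · exact Or.inr ⟨y, hy, ha, hA _ hb⟩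
    · rcases le_total y y' with h | h
      · exact Or.inr ⟨y', hy', mono h ha, hb⟩
      · exact Or.inr ⟨y, hy, ha, mono h hb⟩
  induction hx using Algebra.adjoin_induction with
  | mem x hx =>
    rcases hx with hx | hx
    · exact Or.inl hx
    · exact Or.inr ⟨x, hx, Algebra.subset_adjoin (Or.inr ⟨hx, le_rfl⟩)⟩
  | algebraMap r => exact Or.inl (A.algebraMap_mem r)
  | add a b _ _ ha hb =>
    rcases common ha hb with ⟨ha, hb⟩ | ⟨y, hy, ha, hb⟩
    · exact Or.inl (add_mem ha hb)
    · exact Or.inr ⟨y, hy, add_mem ha hb⟩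
  | mul a b _ _ ha hb =>
    rcases common ha hb with ⟨ha, hb⟩ | ⟨y, hy, ha, hb⟩
    · exact Or.inl (mul_mem ha hb)
    · exact Or.inr ⟨y, hy, mul_mem ha hb⟩

/-- Adjoining the elements of `X` one after the other along a well-order. -/
theorem isJumpSystem_adjoin [LinearOrder H] [WellFoundedLT H] {A : Subalgebra k H} {X : Set H}
    (hX : ∀ Y ⊆ X, IsGradedSubbialgebra 𝒜 (Algebra.adjoin k ((A : Set H) ∪ Y))) :
    IsJumpSystem 𝒜 A (Algebra.adjoin k ((A : Set H) ∪ X))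
      {j | ∃ y ∈ X, y ∉ Algebra.adjoin k ((A : Set H) ∪ (X ∩ Set.Iio y)) ∧
        j = (Algebra.adjoin k ((A : Set H) ∪ (X ∩ Set.Iio y)),
          Algebra.adjoin k ((A : Set H) ∪ (X ∩ Set.Iic y)))} where
  left := by rintro _ ⟨y, hy, h, rfl⟩; exact hX _ Set.inter_subset_left
  right := by rintro _ ⟨y, hy, h, rfl⟩; exact hX _ Set.inter_subset_left
  le_left := by rintro _ ⟨y, hy, h, rfl⟩ x hx; exact Algebra.subset_adjoin (Or.inl hx)
  lt := by
    rintro _ ⟨y, hy, h, rfl⟩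
    refine lt_of_le_not_ge (Algebra.adjoin_mono (Set.union_subset_union_right _
      (Set.inter_subset_inter_right _ Set.Iio_subset_Iic_self))) fun h' => h (h' ?_)
    exact Algebra.subset_adjoin (Or.inr ⟨hy, le_rfl⟩)
  right_le := by
    rintro _ ⟨y, hy, h, rfl⟩
    exact Algebra.adjoin_mono (Set.union_subset_union_right _ Set.inter_subset_left)
  separated := by
    have key : ∀ {y y' : H}, y < y' → Algebra.adjoin k ((A : Set H) ∪ (X ∩ Set.Iic y)) ≤
        Algebra.adjoin k ((A : Set H) ∪ (X ∩ Set.Iio y')) := fun h =>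
      Algebra.adjoin_mono (Set.union_subset_union_right _
        (Set.inter_subset_inter_right _ (Set.Iic_subset_Iio.2 h)))
    rintro _ ⟨y, hy, h, rfl⟩ _ ⟨y', hy', h', rfl⟩
    rcases lt_trichotomy y y' with h | rfl | h
    · exact Or.inr (Or.inl (key h))
    · exact Or.inl rfl
    · exact Or.inr (Or.inr (key h))
  cover n x _ hx hxA := by
    have hne : {y | y ∈ X ∧ x ∈ Algebra.adjoin k ((A : Set H) ∪ (X ∩ Set.Iic y))}.Nonempty :=
      (mem_adjoin_Iic hx).resolve_left hxA
    obtain ⟨y, ⟨hy, hxy⟩, hmin⟩ := wellFounded_lt.has_min _ hne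
    have hx' : x ∉ Algebra.adjoin k ((A : Set H) ∪ (X ∩ Set.Iio y)) := by
      intro h
      obtain ⟨y', ⟨hy', hlt⟩, h'⟩ := (mem_adjoin_Iic h).resolve_left hxA
      refine hmin y' ⟨hy', Algebra.adjoin_mono (Set.union_subset_union_right _ ?_) h'⟩ hlt
      exact Set.inter_subset_inter_left _ Set.inter_subset_left
    -- The least `y` that reaches `x` is not redundant: otherwise adjoining it would change nothing,
    -- and `x` would be reached earlier.
    refine ⟨_, ⟨y, hy, fun hyE => hx' ?_, rfl⟩, hxy, hx'⟩
    refine Algebra.adjoin_le ?_ hxy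
    rintro w (hw | ⟨hwX, hwy⟩)
    · exact Algebra.subset_adjoin (Or.inl hw)
    · rcases (Set.mem_Iic.1 hwy).lt_or_eq with h | rfl
      · exact Algebra.subset_adjoin (Or.inr ⟨hwX, h⟩)
      · exact hyE
  exists_least n S hS hne _ := by
    obtain ⟨j, hj⟩ := hne
    obtain ⟨y, hy, h, rfl⟩ := hS hj
    obtain ⟨m, hm, hmin⟩ := wellFounded_lt.has_min
      {y | (Algebra.adjoin k ((A : Set H) ∪ (X ∩ Set.Iio y)),
          Algebra.adjoin k ((A : Set H) ∪ (X ∩ Set.Iic y))) ∈ S} ⟨y, hj⟩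
    refine ⟨_, hm, fun i hi => ?_⟩
    obtain ⟨w, hw, h, rfl⟩ := hS hi
    exact Algebra.adjoin_mono (Set.union_subset_union_right _ (Set.inter_subset_inter_right _
      (Set.Iio_subset_Iio (not_lt.1 (hmin w hi)))))

/-! ### Refinement degree by degree -/

variable (𝒜) in
/-- `A` and `B` have the same elements of degree at most `n`. -/
def AgreeUpTo (n : ℕ) (A B : Subalgebra k H) : Prop :=
  ∀ m ≤ n, ∀ x ∈ 𝒜 m, x ∈ B → x ∈ A

theorem augPart_zero (hH : IsConnectedGradedHopf 𝒜) (A : Subalgebra k H) {x : H}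
    (hx : x ∈ augPart 𝒜 A 0) : x = 0 := by
  obtain ⟨c, rfl⟩ := exists_smul_one hH hx.2
  have := counit_eq_zero_of_mem_posPart hH hx.1.2
  rw [map_smul, Bialgebra.counit_one, smul_eq_mul, mul_one] at this
  rw [this, zero_smul]

/-- Both factors have positive degree and the degrees add up to `n + 1`, so each is at most `n`,
where `A` and `B` agree. This makes elements of `B` of degree `n + 1` primitive modulo `A`. -/
theorem AgreeUpTo.tensorDeg_le (hH : IsConnectedGradedHopf 𝒜) {n : ℕ} {A B : Subalgebra k H}
    (h : AgreeUpTo 𝒜 n A B) :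
    tensorDeg (augPart 𝒜 B) (n + 1) ≤ tensorDeg (augPart 𝒜 A) (n + 1) := by
  refine ConnGrHopf.tensorDeg_le fun i j hij x hx y hy => ?_
  rcases Nat.eq_zero_or_pos i with rfl | hi
  · rw [augPart_zero hH B hx, TensorProduct.zero_tmul]
    exact zero_mem _
  rcases Nat.eq_zero_or_pos j with rfl | hj
  · rw [augPart_zero hH B hy, TensorProduct.tmul_zero]
    exact zero_mem _
  exact tmul_mem_tensorDeg hij (mem_augPart hi hx.2 (h i (by omega) x hx.2 hx.1.1))
    (mem_augPart hj hy.2 (h j (by omega) y hy.2 hy.1.1))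

/-- A jump that is invisible up to degree `n` decomposes into Ore steps and jumps that are
invisible up to degree `n + 1`. -/
theorem AgreeUpTo.exists_isJumpSystem (hH : IsConnectedGradedHopf 𝒜) {n : ℕ}
    {A B : Subalgebra k H} (hA : IsGradedSubbialgebra 𝒜 A) (hB : IsGradedSubbialgebra 𝒜 B)
    (hAB : A ≤ B) (h : AgreeUpTo 𝒜 n A B) :
    ∃ R, IsJumpSystem 𝒜 A B R ∧
      ∀ j ∈ R, (∃ z d, IsOreStep 𝒜 j.1 j.2 z d) ∨ AgreeUpTo 𝒜 (n + 1) j.1 j.2 := by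
  -- An arbitrary well-order of the underlying set; no compatibility with the algebra is needed.
  obtain ⟨_, _⟩ := exists_wellFoundedLT H
  set X : Set H := {x | x ∈ 𝒜 (n + 1) ∧ x ∈ B} with hXdef
  have hΔ : ∀ x ∈ X, ∃ t ∈ tensorDeg (augPart 𝒜 A) (n + 1),
      comul (R := k) x = 1 ⊗ₜ[k] x + x ⊗ₜ[k] 1 + t := by
    rintro x ⟨hxn, hx⟩
    obtain ⟨t, ht, e⟩ := hB.exists_comul_eq hH (Nat.succ_pos n) hxn hx
    exact ⟨t, h.tensorDeg_le hH ht, e⟩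
  have hX : ∀ Y ⊆ X, IsGradedSubbialgebra 𝒜 (Algebra.adjoin k ((A : Set H) ∪ Y)) := by
    intro Y hY
    refine hA.adjoin (fun s hs => ⟨_, (hY hs).1⟩) fun s hs => ?_
    obtain ⟨t, ht, e⟩ := hΔ s (hY hs)
    have hs' : s ∈ Algebra.adjoin k ((A : Set H) ∪ Y) := Algebra.subset_adjoin (Or.inr hs)
    rw [e]
    refine add_mem (add_mem (tmul_mem_tensorSubalgebra (one_mem _) hs')
      (tmul_mem_tensorSubalgebra hs' (one_mem _))) ?_
    exact tensorSubalgebra_mono (fun y hy => Algebra.subset_adjoin (Or.inl hy))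
      (tensorDeg_augPart_le A _ ht)
  have hAC : A ≤ Algebra.adjoin k ((A : Set H) ∪ X) :=
    fun y hy => Algebra.subset_adjoin (Or.inl hy)
  have hCB : Algebra.adjoin k ((A : Set H) ∪ X) ≤ B :=
    Algebra.adjoin_le (Set.union_subset hAB fun x hx => hx.2)
  have hchain := isJumpSystem_adjoin hX
  have hrefine : ∀ j ∈ {j | ∃ y ∈ X, y ∉ Algebra.adjoin k ((A : Set H) ∪ (X ∩ Set.Iio y)) ∧
        j = (Algebra.adjoin k ((A : Set H) ∪ (X ∩ Set.Iio y)),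
          Algebra.adjoin k ((A : Set H) ∪ (X ∩ Set.Iic y)))},
      ∃ R, IsJumpSystem 𝒜 j.1 j.2 R ∧
        ∀ i ∈ R, (∃ z d, IsOreStep 𝒜 i.1 i.2 z d) ∨ AgreeUpTo 𝒜 (n + 1) i.1 i.2 := by
    rintro j ⟨y, hy, hyE, rfl⟩
    have hE := hX (X ∩ Set.Iio y) Set.inter_subset_left
    have hF := hX (X ∩ Set.Iic y) Set.inter_subset_left
    obtain ⟨t, ht, e⟩ := hΔ y hy
    set E := Algebra.adjoin k ((A : Set H) ∪ (X ∩ Set.Iio y)) with hEdef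
    set F := Algebra.adjoin k ((A : Set H) ∪ (X ∩ Set.Iic y)) with hFdef
    have hAE : A ≤ E := fun y hy => Algebra.subset_adjoin (Or.inl hy)
    have hEF : E ≤ F := Algebra.adjoin_mono (Set.union_subset_union_right _
      (Set.inter_subset_inter_right _ Set.Iio_subset_Iic_self))
    have hyF : y ∈ F := Algebra.subset_adjoin (Or.inr ⟨hy, le_rfl⟩)
    have ht' := tensorDeg_augPart_mono hAE (n + 1) ht
    have hE' := hE.commClosure hy.1 (tensorDeg_augPart_le E _ ht') e
    have hEF' : F = Algebra.adjoin k ((E : Set H) ∪ {y}) := by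
      refine le_antisymm (Algebra.adjoin_le ?_) (Algebra.adjoin_le ?_)
      · rintro w (hw | ⟨hwX, hwy⟩)
        · exact Algebra.subset_adjoin (Or.inl (hAE hw))
        · rcases (Set.mem_Iic.1 hwy).lt_or_eq with h | rfl
          · exact Algebra.subset_adjoin (Or.inl (Algebra.subset_adjoin (Or.inr ⟨hwX, h⟩)))
          · exact Algebra.subset_adjoin (Or.inr rfl)
      · rintro w (hw | rfl)
        · exact hEF hw
        · exact hyF
    -- The jump from `E` to `E[y]` is split at the commutator closure of `E`: the lower half is
    -- invisible up to degree `n + 1`, the upper half is an Ore step.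
    refine ⟨_, (isJumpSystem_single hE hE' (le_commClosure E y)).append
      (isJumpSystem_single hE' hF (commClosure_le hEF hyF)) (le_commClosure E y)
      (commClosure_le hEF hyF), ?_⟩
    rintro i (⟨rfl, -⟩ | ⟨rfl, -⟩)
    · right
      exact fun m hm x hxm hx => commClosure_agrees hH hE.homogeneous hy.1 hm hxm hx
    · left
      exact ⟨y, n + 1, isOreStep_commClosure hH hE (Nat.succ_pos n) hy.1 hyE ⟨t, ht', e⟩ hEF'⟩
  choose! R hR hR' using hrefine
  refine ⟨_, (hchain.biUnion hR).append (isJumpSystem_single (hX X subset_rfl) hB hCB) hAC hCB, ?_⟩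
  rintro j (hj | ⟨rfl, -⟩)
  · obtain ⟨i, hi, hj⟩ := Set.mem_iUnion₂.1 hj
    exact hR' i hi j hj
  · right
    intro m hm x hxm hx
    rcases Nat.le_succ_iff.1 hm with hm | rfl
    · exact hAC (h m hm x hxm hx)
    · exact Algebra.subset_adjoin (Or.inr ⟨hxm, hx⟩)

theorem IsJumpSystem.eq_of_mem {A B : Subalgebra k H} {J : Set (Subalgebra k H × Subalgebra k H)}
    (hJ : IsJumpSystem 𝒜 A B J) {i j : Subalgebra k H × Subalgebra k H} (hi : i ∈ J) (hj : j ∈ J)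
    {x : H} (hi2 : x ∈ i.2) (hi1 : x ∉ i.1) (hj2 : x ∈ j.2) (hj1 : x ∉ j.1) : i = j := by
  rcases hJ.separated i hi j hj with h | h | h
  · exact h
  · exact absurd (h hi2) hj1
  · exact absurd (h hj2) hi1

/-- Only jumps that are not Ore steps get refined. Keeping the others unchanged is what allows
passage to a limit. -/
theorem IsJumpSystem.exists_refinement (hH : IsConnectedGradedHopf 𝒜) {n : ℕ}
    {A B : Subalgebra k H} {J : Set (Subalgebra k H × Subalgebra k H)}
    (hJ : IsJumpSystem 𝒜 A B J)
    (h : ∀ j ∈ J, (∃ z d, IsOreStep 𝒜 j.1 j.2 z d) ∨ AgreeUpTo 𝒜 n j.1 j.2) :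
    ∃ J', IsJumpSystem 𝒜 A B J' ∧
      (∀ j ∈ J', (∃ z d, IsOreStep 𝒜 j.1 j.2 z d) ∨ AgreeUpTo 𝒜 (n + 1) j.1 j.2) ∧
      ∀ j ∈ J, (∃ z d, IsOreStep 𝒜 j.1 j.2 z d) → j ∈ J' := by
  have key : ∀ j ∈ J, ∃ R, IsJumpSystem 𝒜 j.1 j.2 R ∧
      (∀ i ∈ R, (∃ z d, IsOreStep 𝒜 i.1 i.2 z d) ∨ AgreeUpTo 𝒜 (n + 1) i.1 i.2) ∧
      ((∃ z d, IsOreStep 𝒜 j.1 j.2 z d) → j ∈ R) := by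
    intro j hj
    by_cases ho : ∃ z d, IsOreStep 𝒜 j.1 j.2 z d
    · refine ⟨_, isJumpSystem_single (hJ.left j hj) (hJ.right j hj) (hJ.lt j hj).le, ?_,
        fun _ => ⟨rfl, hJ.lt j hj⟩⟩
      rintro i ⟨rfl, -⟩
      exact Or.inl ho
    · obtain ⟨R, hR, hR'⟩ := ((h j hj).resolve_left ho).exists_isJumpSystem hH (hJ.left j hj)
        (hJ.right j hj) (hJ.lt j hj).le
      exact ⟨R, hR, hR', fun h => absurd h ho⟩
  choose! R hR hR' hR'' using key
  refine ⟨_, hJ.biUnion hR, fun i hi => ?_, fun j hj ho =>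
    Set.mem_iUnion₂.2 ⟨j, hj, hR'' j hj ho⟩⟩
  obtain ⟨j, hj, hi⟩ := Set.mem_iUnion₂.1 hi
  exact hR' j hj i hi

/-- Any inclusion of graded sub-bialgebras decomposes into Ore steps. -/
theorem exists_isJumpSystem_isOreStep (hH : IsConnectedGradedHopf 𝒜) {A B : Subalgebra k H}
    (hA : IsGradedSubbialgebra 𝒜 A) (hB : IsGradedSubbialgebra 𝒜 B) (hAB : A ≤ B) :
    ∃ J, IsJumpSystem 𝒜 A B J ∧ ∀ j ∈ J, ∃ z d, IsOreStep 𝒜 j.1 j.2 z d := by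
  have step := fun (n : ℕ) (J : {J // IsJumpSystem 𝒜 A B J ∧
      ∀ j ∈ J, (∃ z d, IsOreStep 𝒜 j.1 j.2 z d) ∨ AgreeUpTo 𝒜 n j.1 j.2}) =>
    IsJumpSystem.exists_refinement hH J.2.1 J.2.2
  choose f hf hf' hf'' using step
  have h0 : ∀ j ∈ {j | j = (A, B) ∧ A < B},
      (∃ z d, IsOreStep 𝒜 j.1 j.2 z d) ∨ AgreeUpTo 𝒜 0 j.1 j.2 := by
    rintro j ⟨rfl, -⟩
    right
    intro m hm x hx _
    obtain rfl : m = 0 := by omega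
    obtain ⟨c, rfl⟩ := exists_smul_one hH hx
    exact A.smul_mem (one_mem _) c
  let F : ∀ n : ℕ, {J // IsJumpSystem 𝒜 A B J ∧
      ∀ j ∈ J, (∃ z d, IsOreStep 𝒜 j.1 j.2 z d) ∨ AgreeUpTo 𝒜 n j.1 j.2} := fun n =>
    Nat.rec ⟨_, isJumpSystem_single hA hB hAB, h0⟩ (fun n J => ⟨f n J, hf n J, hf' n J⟩) n
  have hstep : ∀ n, ∀ j ∈ (F n).1, (∃ z d, IsOreStep 𝒜 j.1 j.2 z d) → j ∈ (F (n + 1)).1 :=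
    fun n => hf'' n (F n)
  have hkeep : ∀ {m n}, m ≤ n → ∀ j ∈ (F m).1, (∃ z d, IsOreStep 𝒜 j.1 j.2 z d) →
      j ∈ (F n).1 := by
    intro m n hmn j hj ho
    induction n, hmn using Nat.le_induction with
    | base => exact hj
    | succ n _ ih => exact hstep n j ih ho
  -- At stage `n`, a jump that is not an Ore step is invisible up to degree `n`, so degree `n` is
  -- already settled.
  have hactive : ∀ n, ∀ j ∈ (F n).1, IsActive 𝒜 n j → ∃ z d, IsOreStep 𝒜 j.1 j.2 z d := by
    rintro n j hj ⟨x, hxn, h2, h1⟩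
    exact ((F n).2.2 j hj).resolve_right fun h => h1 (h n le_rfl x hxn h2)
  have hcover : ∀ n, ∀ x ∈ 𝒜 n, x ∈ B → x ∉ A → ∃ j ∈ (F n).1,
      (∃ z d, IsOreStep 𝒜 j.1 j.2 z d) ∧ x ∈ j.2 ∧ x ∉ j.1 := by
    intro n x hxn hxB hxA
    obtain ⟨j, hj, h2, h1⟩ := (F n).2.1.cover n x hxn hxB hxA
    exact ⟨j, hj, hactive n j hj ⟨x, hxn, h2, h1⟩, h2, h1⟩
  -- The limit system consists of the Ore steps of all stages.
  refine ⟨{j | (∃ z d, IsOreStep 𝒜 j.1 j.2 z d) ∧ ∃ n, j ∈ (F n).1}, ?_, fun j hj => hj.1⟩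
  refine
    { left := fun j ⟨_, n, hj⟩ => (F n).2.1.left j hj
      right := fun j ⟨_, n, hj⟩ => (F n).2.1.right j hj
      le_left := fun j ⟨_, n, hj⟩ => (F n).2.1.le_left j hj
      lt := fun j ⟨_, n, hj⟩ => (F n).2.1.lt j hj
      right_le := fun j ⟨_, n, hj⟩ => (F n).2.1.right_le j hj
      separated := ?_
      cover := ?_
      exists_least := ?_ }
  · rintro i ⟨hio, m, hi⟩ j ⟨hjo, n, hj⟩
    exact (F (max m n)).2.1.separated i (hkeep (le_max_left _ _) i hi hio) j
      (hkeep (le_max_right _ _) j hj hjo)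
  · intro n x hxn hxB hxA
    obtain ⟨j, hj, ho, h⟩ := hcover n x hxn hxB hxA
    exact ⟨j, ⟨ho, n, hj⟩, h⟩
  · intro n S hS hne hact
    -- Every limit jump active in degree `n` already occurs at stage `n`: its witness crosses an Ore
    -- step there, and at a common later stage an element crosses only one jump.
    refine (F n).2.1.exists_least n S (fun j hjS => ?_) hne hact
    obtain ⟨ho, m, hj⟩ := hS hjS
    obtain ⟨x, hxn, h2, h1⟩ := hact j hjS
    obtain ⟨i, hi, hio, hi2, hi1⟩ := hcover n x hxn ((F m).2.1.right_le j hj h2)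
      fun h => h1 ((F m).2.1.le_left j hj h)
    have := (F (max m n)).2.1.eq_of_mem (hkeep (le_max_left _ _) j hj ho)
      (hkeep (le_max_right _ _) i hi hio) h2 h1 hi2 hi1
    rwa [this]

end ConnGrHopf

namespace ConnGrHopf

open Coalgebra

set_option linter.unusedSectionVars false

variable {k H : Type*} [Field k] [Ring H] [HopfAlgebra k H]
variable {𝒜 : ℕ → Submodule k H} [GradedAlgebra 𝒜]

/-! ### The derivation attached to an Ore step -/

theorem IsOreStep.mem_left_of_lt {A B : Subalgebra k H} {z : H} {d : ℕ} (h : IsOreStep 𝒜 A B z d)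
    (hA : IsGradedSubbialgebra 𝒜 A) {m : ℕ} (hm : m < d) {x : H} (hxm : x ∈ 𝒜 m) (hx : x ∈ B) :
    x ∈ A := by
  rw [h.eq_adjoin] at hx
  refine mem_of_mem_adjoin_of_degree_le hA.homogeneous (N := d - 1) ?_ (by omega) hxm hx
  rintro s rfl
  exact Or.inr ⟨d, by have := h.pos; omega, h.mem_graded⟩

/-- A functional on `H` that vanishes on `A`, takes the value `1` at `z`, and is a derivation
along the counit on `B`. -/
theorem IsOreStep.exists_functional (hH : IsConnectedGradedHopf 𝒜) {A B : Subalgebra k H} {z : H}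
    {d : ℕ} (h : IsOreStep 𝒜 A B z d) (hA : IsGradedSubbialgebra 𝒜 A)
    (hB : IsGradedSubbialgebra 𝒜 B) :
    ∃ φ : H →ₗ[k] k, (∀ x ∈ A, φ x = 0) ∧ φ z = 1 ∧
      ∀ x ∈ B, ∀ y ∈ B, φ (x * y) = counit (R := k) x * φ y + φ x * counit (R := k) y := by
  obtain ⟨f, hfz, hf⟩ := Submodule.exists_le_ker_of_notMem
    (p := Subalgebra.toSubmodule A) (v := z) h.notMem
  -- Composing with the projection makes `φ` see only degree `d`, without losing its vanishing on
  -- the homogeneous algebra `A`.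
  set φ : H →ₗ[k] k := (f z)⁻¹ • (f ∘ₗ GradedAlgebra.proj 𝒜 d) with hφ
  have hφA : ∀ x ∈ A, φ x = 0 := by
    intro x hx
    have : f (GradedAlgebra.proj 𝒜 d x) = 0 := hf (hA.proj_mem hx d)
    rw [hφ, LinearMap.smul_apply, LinearMap.comp_apply, this, smul_zero]
  have hφne : ∀ {m : ℕ} {x : H}, x ∈ 𝒜 m → m ≠ d → φ x = 0 := by
    intro m x hx hm
    simp [hφ, proj_of_mem_ne hx hm]
  refine ⟨φ, hφA, by simp [hφ, proj_of_mem h.mem_graded, hfz], fun x hx y hy => ?_⟩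
  refine homogeneous_induction (𝒜 := 𝒜) (M := Subalgebra.toSubmodule B)
    (fun x hx n => hB.proj_mem hx n)
    (P := fun x => φ (x * y) = counit (R := k) x * φ y + φ x * counit (R := k) y)
    (by simp) (fun a b ha hb => by rw [add_mul, map_add, ha, hb, map_add, map_add]; ring) ?_ hx
  intro i x hxi hxB
  refine homogeneous_induction (𝒜 := 𝒜) (M := Subalgebra.toSubmodule B)
    (fun x hx n => hB.proj_mem hx n)
    (P := fun y => φ (x * y) = counit (R := k) x * φ y + φ x * counit (R := k) y)
    (by simp) (fun a b ha hb => by rw [mul_add, map_add, ha, hb, map_add, map_add]; ring) ?_ hy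
  intro j y hyj hyB
  have hd := h.pos
  have hφ1 : φ 1 = 0 := hφA 1 (one_mem _)
  rcases Nat.eq_zero_or_pos i with rfl | hi
  · obtain ⟨c, rfl⟩ := exists_smul_one hH hxi
    simp [hφ1]
  rcases Nat.eq_zero_or_pos j with rfl | hj
  · obtain ⟨c, rfl⟩ := exists_smul_one hH hyj
    simp [hφ1, mul_comm]
  rw [hH.counit_eq_zero i hi x hxi, hH.counit_eq_zero j hj y hyj, zero_mul, mul_zero, add_zero]
  -- If the degrees add up to `d`, both are smaller than `d`, where `B` agrees with `A`, so the
  -- product lies in `A`. Otherwise the product is not in degree `d`.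
  by_cases hij : i + j = d
  · exact hφA _ (mul_mem (h.mem_left_of_lt hA (by omega) hxi hxB)
      (h.mem_left_of_lt hA (by omega) hyj hyB))
  · exact hφne (SetLike.mul_mem_graded hxi hyj) hij

/-- Take `D = (id ⊗ φ)Δ`. The Leibniz rule follows from that of `φ` along the counit together with
`(id ⊗ ε)Δ = id`. In the coproduct of `z` only `1 ⊗ z` survives, as `φ` kills `A`. -/
theorem IsOreStep.exists_derivation (hH : IsConnectedGradedHopf 𝒜) {A B : Subalgebra k H} {z : H}
    {d : ℕ} (h : IsOreStep 𝒜 A B z d) (hA : IsGradedSubbialgebra 𝒜 A)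
    (hB : IsGradedSubbialgebra 𝒜 B) :
    ∃ D : H →ₗ[k] H, (∀ x ∈ A, D x = 0) ∧ D z = 1 ∧
      ∀ x ∈ B, ∀ y ∈ B, D (x * y) = D x * y + x * D y := by
  obtain ⟨φ, hφA, hφz, hφ⟩ := h.exists_functional hH hA hB
  let T : (H →ₗ[k] k) → H ⊗[k] H →ₗ[k] H := fun ψ =>
    (TensorProduct.rid k H).toLinearMap ∘ₗ ψ.lTensor H
  have hT : ∀ ψ a b, T ψ (a ⊗ₜ[k] b) = ψ b • a := fun ψ a b => by simp [T]
  have hTA : ∀ t ∈ tensorSubalgebra A, T φ t = 0 := by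
    intro t ht
    suffices h : tensorSub (Subalgebra.toSubmodule A) (Subalgebra.toSubmodule A) ≤
      LinearMap.ker (T φ) from h ht
    refine tensorSub_le fun a ha b hb => ?_
    rw [LinearMap.mem_ker, hT, hφA b hb, zero_smul]
  have hTmul : ∀ t ∈ tensorSubalgebra B, ∀ s ∈ tensorSubalgebra B,
      T φ (t * s) = T φ t * T counit s + T counit t * T φ s := by
    intro t ht s hs
    suffices h : tensorSub (Subalgebra.toSubmodule B) (Subalgebra.toSubmodule B) ≤
        LinearMap.eqLocus (T φ ∘ₗ LinearMap.mulRight k s)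
          (LinearMap.mulRight k (T counit s) ∘ₗ T φ + LinearMap.mulRight k (T φ s) ∘ₗ T counit) from
      h ht
    refine tensorSub_le fun a ha b hb => ?_
    suffices h : tensorSub (Subalgebra.toSubmodule B) (Subalgebra.toSubmodule B) ≤
        LinearMap.eqLocus (T φ ∘ₗ LinearMap.mulLeft k (a ⊗ₜ[k] b))
          (LinearMap.mulLeft k (T φ (a ⊗ₜ[k] b)) ∘ₗ T counit +
            LinearMap.mulLeft k (T counit (a ⊗ₜ[k] b)) ∘ₗ T φ) from h hs
    refine tensorSub_le fun a' ha' b' hb' => ?_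
    simp only [LinearMap.mem_eqLocus, LinearMap.comp_apply, LinearMap.add_apply,
      LinearMap.mulLeft_apply, Algebra.TensorProduct.tmul_mul_tmul, hT, hφ b hb b' hb',
      smul_mul_smul_comm, add_smul]
    rw [add_comm]
  have hTcounit : ∀ x : H, T counit (comul x) = x := by
    intro x
    simp [T, Coalgebra.lTensor_counit_comul]
  refine ⟨T φ ∘ₗ comul, fun x hx => hTA _ (hA.comul_mem x hx), ?_,
    fun x hx y hy => ?_⟩
  · obtain ⟨t, ht, e⟩ := h.comul_eq
    rw [LinearMap.comp_apply, e, map_add, map_add, hT, hT, hTA t (tensorDeg_augPart_le A _ ht),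
      hφz, hφA 1 (one_mem _)]
    simp
  · rw [LinearMap.comp_apply, Bialgebra.comul_mul, hTmul _ (hB.comul_mem x hx) _
      (hB.comul_mem y hy), hTcounit, hTcounit]
    rfl

theorem iterate_derivation_pow {A B : Subalgebra k H} {D : H →ₗ[k] H} {z : H}
    (hAB : A ≤ B) (hz : z ∈ B) (hDA : ∀ x ∈ A, D x = 0) (hDz : D z = 1)
    (hD : ∀ x ∈ B, ∀ y ∈ B, D (x * y) = D x * y + x * D y) {a c : H} (ha : a ∈ A) (hc : c ∈ A)
    (N n : ℕ) :
    (D ^ N) (a * z ^ n * c) = (n.descFactorial N : k) • (a * z ^ (n - N) * c) := by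
  have hpow : ∀ n : ℕ, D (z ^ n) = (n : k) • z ^ (n - 1) := by
    intro n
    induction n with
    | zero => simpa using hDA 1 (one_mem _)
    | succ n ih =>
      rw [pow_succ, hD _ (pow_mem hz n) _ hz, ih, hDz, mul_one, smul_mul_assoc]
      rcases n with _ | n
      · simp
      · rw [Nat.add_sub_cancel, ← pow_succ, Nat.add_sub_cancel, Nat.cast_add (n + 1) 1, add_smul,
          Nat.cast_one, one_smul]
  induction N with
  | zero => simp
  | succ N ih =>
    rw [pow_succ', Module.End.mul_apply, ih, map_smul,
      hD _ (mul_mem (hAB ha) (pow_mem hz _)) _ (hAB hc), hDA c hc, mul_zero, add_zero,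
      hD _ (hAB ha) _ (pow_mem hz _), hDA a ha, zero_mul, zero_add, hpow, mul_smul_comm,
      smul_mul_assoc, smul_smul, Nat.descFactorial_succ, Nat.cast_mul, Nat.sub_sub, mul_comm]

/-- In a relation whose highest power with a nonzero coefficient is `z^N`, applying `D^N` kills the
lower powers and leaves `N!` times a relation among the `v i`. The abstract ring `R`, acting through
two-sided multiplications, covers left and right modules together. -/
theorem IsOreStep.linearIndependent_mul_pow [CharZero k] (hH : IsConnectedGradedHopf 𝒜)
    {A B : Subalgebra k H} {z : H}
    {d : ℕ} (h : IsOreStep 𝒜 A B z d) (hA : IsGradedSubbialgebra 𝒜 A)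
    (hB : IsGradedSubbialgebra 𝒜 B) {R : Type*} [Ring R] [Module R H]
    (hR : ∀ r : R, ∃ c ∈ A, ∃ c' ∈ A, ∀ x : H, r • x = c * x * c') {ι : Type*} {v : ι → H}
    (hvA : ∀ i, v i ∈ A) (hv : LinearIndependent R v) :
    LinearIndependent R (fun p : ι × ℕ => v p.1 * z ^ p.2) := by
  classical
  obtain ⟨D, hDA, hDz, hD⟩ := h.exists_derivation hH hA hB
  have hterm : ∀ (r : R) (i : ι) (N n : ℕ), (D ^ N) (r • (v i * z ^ n)) =
      (n.descFactorial N : k) • (r • (v i * z ^ (n - N))) := by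
    intro r i N n
    obtain ⟨c, hc, c', hc', e⟩ := hR r
    rw [e, e, ← mul_assoc, ← mul_assoc]
    exact iterate_derivation_pow h.le h.mem hDA hDz hD (mul_mem hc (hvA i)) hc' N n
  rw [linearIndependent_iff']
  intro s g hg p hp
  by_contra hne
  obtain ⟨q, hq, hmax⟩ := Finset.exists_max_image (s.filter fun p => g p ≠ 0) Prod.snd
    ⟨p, Finset.mem_filter.2 ⟨hp, hne⟩⟩
  rw [Finset.mem_filter] at hq
  set N := q.2 with hN
  have h1 := congrArg (D ^ N) hg
  rw [map_sum, map_zero] at h1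
  have h2 : ∑ x ∈ s.filter (fun p => p.2 = N), g x • v x.1 = 0 := by
    have h3 : ∑ x ∈ s, (D ^ N) (g x • (v x.1 * z ^ x.2)) =
        ∑ x ∈ s, if x.2 = N then (N.factorial : k) • (g x • v x.1) else 0 := by
      refine Finset.sum_congr rfl fun x hx => ?_
      rw [hterm]
      split_ifs with hxN
      · rw [hxN, Nat.descFactorial_self, Nat.sub_self, pow_zero, mul_one]
      · by_cases hgx : g x = 0
        · simp [hgx]
        · have : x.2 < N := lt_of_le_of_ne (hmax x (Finset.mem_filter.2 ⟨hx, hgx⟩)) hxN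
          simp [Nat.descFactorial_of_lt this]
    rw [h3, ← Finset.sum_filter, ← Finset.smul_sum] at h1
    exact (smul_eq_zero.1 h1).resolve_left (Nat.cast_ne_zero.2 N.factorial_ne_zero)
  have h4 : ∑ i ∈ (s.filter fun p => p.2 = N).image Prod.fst, g (i, N) • v i = 0 := by
    rw [Finset.sum_image, ← h2]
    · refine Finset.sum_congr rfl fun x hx => ?_
      rw [← (Finset.mem_filter.1 hx).2]
    · intro x hx y hy hxy
      exact Prod.ext hxy ((Finset.mem_filter.1 hx).2.trans (Finset.mem_filter.1 hy).2.symm)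
  have h5 := linearIndependent_iff'.1 hv _ _ h4 q.1
    (Finset.mem_image.2 ⟨q, Finset.mem_filter.2 ⟨hq.1, rfl⟩, rfl⟩)
  exact hq.2 h5

/-! ### Powers of the new generator -/

variable (𝒜) in
/-- The span of the homogeneous products `a * z ^ j` of degree `n` with `a ∈ A` and `j < r`. -/
def powSpan (A : Subalgebra k H) (z : H) (d r n : ℕ) : Submodule k H :=
  Submodule.span k {x | ∃ a ∈ A, ∃ i j, a ∈ 𝒜 i ∧ j < r ∧ i + j * d = n ∧ x = a * z ^ j}

theorem mem_powSpan {A : Subalgebra k H} {z : H} {d r n i j : ℕ} {a : H} (ha : a ∈ A)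
    (hai : a ∈ 𝒜 i) (hj : j < r) (h : i + j * d = n) : a * z ^ j ∈ powSpan 𝒜 A z d r n :=
  Submodule.subset_span ⟨a, ha, i, j, hai, hj, h, rfl⟩

theorem mul_mem_powSpan {A : Subalgebra k H} {z : H} {d r n i : ℕ} {a x : H} (ha : a ∈ A)
    (hai : a ∈ 𝒜 i) (hx : x ∈ powSpan 𝒜 A z d r n) : a * x ∈ powSpan 𝒜 A z d r (i + n) := by
  suffices h : powSpan 𝒜 A z d r n ≤ (powSpan 𝒜 A z d r (i + n)).comap (LinearMap.mulLeft k a) from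
    h hx
  refine Submodule.span_le.2 ?_
  rintro _ ⟨b, hb, l, j, hbl, hj, hn, rfl⟩
  change a * (b * z ^ j) ∈ powSpan 𝒜 A z d r (i + n)
  rw [← mul_assoc]
  exact mem_powSpan (mul_mem ha hb) (SetLike.mul_mem_graded hai hbl) hj (by omega)

theorem IsOreStep.mul_mem_powSpan {A B : Subalgebra k H} {z : H} {d : ℕ}
    (h : IsOreStep 𝒜 A B z d) {r n : ℕ} {x : H} (hx : x ∈ powSpan 𝒜 A z d r n) :
    z * x ∈ powSpan 𝒜 A z d (r + 1) (n + d) := by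
  suffices h : powSpan 𝒜 A z d r n ≤
    (powSpan 𝒜 A z d (r + 1) (n + d)).comap (LinearMap.mulLeft k z) from h hx
  refine Submodule.span_le.2 ?_
  rintro _ ⟨b, hb, l, j, hbl, hj, hn, rfl⟩
  change z * (b * z ^ j) ∈ powSpan 𝒜 A z d (r + 1) (n + d)
  have e : z * (b * z ^ j) = b * z ^ (j + 1) + commWith z b * z ^ j := by
    rw [commWith, pow_succ']; noncomm_ring
  rw [e]
  refine add_mem (mem_powSpan hb hbl (by omega) ?_) (mem_powSpan (h.commWith_mem b hb)
    (commWith_mem_graded h.mem_graded hbl) (by omega) (by omega))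
  rw [Nat.succ_mul]; omega

/-- Rests on the recursion `[z^(r+1), c] = z [z^r, c] + [z, c] z^r`, which preserves total degree.
-/
theorem IsOreStep.pow_mul_sub_mem {A B : Subalgebra k H} {z : H} {d : ℕ}
    (h : IsOreStep 𝒜 A B z d) {i : ℕ} {c : H} (hc : c ∈ A) (hci : c ∈ 𝒜 i) (r : ℕ) :
    z ^ r * c - c * z ^ r ∈ powSpan 𝒜 A z d r (i + r * d) := by
  induction r with
  | zero => simp
  | succ r ih =>
    have e : z ^ (r + 1) * c - c * z ^ (r + 1) =
        z * (z ^ r * c - c * z ^ r) + commWith z c * z ^ r := by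
      rw [commWith, pow_succ']; noncomm_ring
    rw [e]
    refine add_mem ?_ (mem_powSpan (h.commWith_mem c hc)
      (commWith_mem_graded h.mem_graded hci) (Nat.lt_succ_self r) ?_)
    · have := h.mul_mem_powSpan ih
      rwa [add_assoc, ← Nat.succ_mul] at this
    · rw [Nat.succ_mul]; omega

/-- The span of all `a * z ^ j` contains `1` and is stable under left multiplication by `A` and by
`z`, hence by `B`. Projecting to degree `n` makes the expression homogeneous. -/
theorem IsOreStep.mem_powSpan_of_mem {A B : Subalgebra k H} {z : H} {d : ℕ}
    (h : IsOreStep 𝒜 A B z d) (hA : IsGradedSubbialgebra 𝒜 A) {n : ℕ} {x : H} (hxn : x ∈ 𝒜 n)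
    (hx : x ∈ B) : x ∈ powSpan 𝒜 A z d (n + 1) n := by
  let N : Submodule k H := Submodule.span k {x | ∃ a ∈ A, ∃ j : ℕ, x = a * z ^ j}
  have hmem : ∀ a ∈ A, ∀ j : ℕ, a * z ^ j ∈ N := fun a ha j => Submodule.subset_span ⟨a, ha, j, rfl⟩
  let S : Subalgebra k H :=
    { carrier := {x | ∀ y ∈ N, x * y ∈ N}
      mul_mem' := fun {a b} ha hb y hy => by rw [mul_assoc]; exact ha _ (hb _ hy)
      add_mem' := fun {a b} ha hb y hy => by rw [add_mul]; exact add_mem (ha _ hy) (hb _ hy)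
      algebraMap_mem' := fun r y hy => by
        rw [← Algebra.smul_def]
        exact N.smul_mem r hy }
  have hS : ∀ w, (∀ a ∈ A, ∀ j : ℕ, w * (a * z ^ j) ∈ N) → w ∈ S := by
    intro w hw y hy
    suffices h : N ≤ N.comap (LinearMap.mulLeft k w) from h hy
    refine Submodule.span_le.2 ?_
    rintro _ ⟨a, ha, j, rfl⟩
    exact hw a ha j
  have hBS : B ≤ S := by
    rw [h.eq_adjoin]
    refine Algebra.adjoin_le ?_
    rintro w (hw | rfl)
    · refine hS w fun a ha j => ?_
      rw [← mul_assoc]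
      exact hmem _ (mul_mem hw ha) j
    · refine hS w fun a ha j => ?_
      have e : w * (a * w ^ j) = a * w ^ (j + 1) + commWith w a * w ^ j := by
        rw [commWith, pow_succ']; noncomm_ring
      rw [e]
      exact add_mem (hmem a ha _) (hmem _ (h.commWith_mem a ha) j)
  have hxN : x ∈ N := by
    have := hBS hx 1 (by simpa using hmem 1 (one_mem _) 0)
    rwa [mul_one] at this
  have hproj : N ≤ (powSpan 𝒜 A z d (n + 1) n).comap (GradedAlgebra.proj 𝒜 n) := by
    refine Submodule.span_le.2 ?_
    rintro _ ⟨a, ha, j, rfl⟩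
    have hzj : z ^ j ∈ 𝒜 (j * d) := by
      have := SetLike.pow_mem_graded j h.mem_graded
      rwa [smul_eq_mul] at this
    change GradedAlgebra.proj 𝒜 n (a * z ^ j) ∈ powSpan 𝒜 A z d (n + 1) n
    by_cases hjn : j * d ≤ n
    · rw [GradedAlgebra.proj_apply, DirectSum.coe_decompose_mul_of_right_mem_of_le 𝒜 hzj hjn,
        ← GradedAlgebra.proj_apply]
      -- Positivity of `d` bounds the exponent by `n`, whence the `n + 1` in the conclusion.
      have : j ≤ j * d := Nat.le_mul_of_pos_right j h.pos
      exact mem_powSpan (hA.proj_mem ha _) (proj_mem _ _ _) (by omega) (by omega)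
    · rw [GradedAlgebra.proj_apply, DirectSum.coe_decompose_mul_of_right_mem_of_not_le 𝒜 hzj hjn]
      exact zero_mem _
  have := hproj hxN
  rwa [Submodule.mem_comap, proj_of_mem hxn] at this

end ConnGrHopf

namespace ConnGrHopf

open Coalgebra

set_option linter.unusedSectionVars false

variable {k H : Type*} [Field k] [Ring H] [HopfAlgebra k H]
variable {𝒜 : ℕ → Submodule k H} [GradedAlgebra 𝒜]

/-! ### Ordered monomials -/

section Monomials

variable {Γ : Type*} [LinearOrder Γ]

/-- A nondecreasing sequence below `a`, followed by `n` copies of `a`. -/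
def appendReplicate (w : {l : List Γ // l.Pairwise (· ≤ ·)}) (a : Γ) (h : ∀ γ ∈ w.1, γ < a)
    (n : ℕ) : {l : List Γ // l.Pairwise (· ≤ ·)} :=
  ⟨w.1 ++ List.replicate n a, List.pairwise_append.2 ⟨w.2, List.pairwise_replicate.2 (by simp),
    fun x hx y hy => by rw [List.eq_of_mem_replicate hy]; exact (h x hx).le⟩⟩

theorem orderedMonomial_appendReplicate (z : Γ → H) (w : {l : List Γ // l.Pairwise (· ≤ ·)})
    (a : Γ) (h : ∀ γ ∈ w.1, γ < a) (n : ℕ) :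
    orderedMonomial z (appendReplicate w a h n) = orderedMonomial z w * z a ^ n := by
  simp [orderedMonomial, appendReplicate]

theorem exists_eq_appendReplicate (w : {l : List Γ // l.Pairwise (· ≤ ·)}) (a : Γ)
    (h : ∀ γ ∈ w.1, γ ≤ a) : ∃ (w' : {l : List Γ // l.Pairwise (· ≤ ·)}) (n : ℕ)
      (h' : ∀ γ ∈ w'.1, γ < a), (∀ γ ∈ w'.1, γ ∈ w.1) ∧ w = appendReplicate w' a h' n := by
  classical
  have h' : ∀ γ ∈ w.1.filter (fun γ => decide (γ < a)), γ < a := by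
    intro γ hγ
    simpa using (List.mem_filter.1 hγ).2
  refine ⟨⟨w.1.filter (fun γ => decide (γ < a)), w.2.filter _⟩,
    (w.1.filter (fun γ => !decide (γ < a))).length, h', fun γ hγ => (List.mem_filter.1 hγ).1,
    Subtype.ext ?_⟩
  refine List.Perm.eq_of_pairwise' w.2 (appendReplicate _ a h' _).2 ?_
  have e : List.replicate (w.1.filter (fun γ => !decide (γ < a))).length a =
      w.1.filter (fun γ => !decide (γ < a)) := by
    refine (List.eq_replicate_of_mem fun γ hγ => ?_).symm
    obtain ⟨h1, h2⟩ := List.mem_filter.1 hγ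
    exact le_antisymm (h γ h1) (by simpa using h2)
  change w.1.Perm (w.1.filter (fun γ => decide (γ < a)) ++
    List.replicate (w.1.filter (fun γ => !decide (γ < a))).length a)
  rw [e]
  exact (List.filter_append_perm _ _).symm

end Monomials

variable (𝒜) in
/-- A totally ordered family of Ore steps from `L γ` to `R γ` that leads from `A₀` to `B₀`. -/
structure IsPBWFamily (A₀ B₀ : Subalgebra k H) {Γ : Type*} [LinearOrder Γ]
    (L R : Γ → Subalgebra k H) (z : Γ → H) (d : Γ → ℕ) : Prop where
  left : ∀ γ, IsGradedSubbialgebra 𝒜 (L γ)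
  right : ∀ γ, IsGradedSubbialgebra 𝒜 (R γ)
  le_left : ∀ γ, A₀ ≤ L γ
  right_le : ∀ γ, R γ ≤ B₀
  isOreStep : ∀ γ, IsOreStep 𝒜 (L γ) (R γ) (z γ) (d γ)
  right_le_left : ∀ γ δ, γ < δ → R γ ≤ L δ
  cover : ∀ n, ∀ x ∈ 𝒜 n, x ∈ B₀ → x ∉ A₀ → ∃ γ, x ∈ R γ ∧ x ∉ L γ
  exists_least : ∀ n, ∀ S : Set Γ, S.Nonempty → (∀ γ ∈ S, ∃ x ∈ 𝒜 n, x ∈ R γ ∧ x ∉ L γ) →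
    ∃ m ∈ S, ∀ γ ∈ S, m ≤ γ

/-- Jumps are ordered by their left ends; `separated` makes this total and shows that a jump is
determined by its left end. -/
theorem IsJumpSystem.exists_isPBWFamily {A₀ B₀ : Subalgebra k H}
    {J : Set (Subalgebra k H × Subalgebra k H)} (hJ : IsJumpSystem 𝒜 A₀ B₀ J)
    (hO : ∀ j ∈ J, ∃ z d, IsOreStep 𝒜 j.1 j.2 z d) :
    ∃ (_ : LinearOrder J) (z : J → H) (d : J → ℕ),
      IsPBWFamily 𝒜 A₀ B₀ (fun j : J => j.1.1) (fun j : J => j.1.2) z d := by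
  classical
  choose z d hzd using fun j : J => hO j.1 j.2
  have hanti : ∀ i j : J, i.1.1 ≤ j.1.1 → j.1.1 ≤ i.1.1 → i = j := by
    intro i j hij hji
    rcases hJ.separated i i.2 j j.2 with h | h | h
    · exact Subtype.ext h
    · exact absurd ((hJ.lt i i.2).trans_le (h.trans hji)) (lt_irrefl _)
    · exact absurd ((hJ.lt j j.2).trans_le (h.trans hij)) (lt_irrefl _)
  let o : LinearOrder J :=
    { le := fun i j => i.1.1 ≤ j.1.1
      lt := fun i j => i.1.1 ≤ j.1.1 ∧ ¬ j.1.1 ≤ i.1.1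
      lt_iff_le_not_ge := fun _ _ => Iff.rfl
      le_refl := fun i => le_refl i.1.1
      le_trans := fun i j l hij hjl => le_trans hij hjl
      le_antisymm := hanti
      le_total := fun i j => by
        rcases hJ.separated i i.2 j j.2 with h | h | h
        · exact Or.inl (by rw [h])
        · exact Or.inl ((hJ.lt i i.2).le.trans h)
        · exact Or.inr ((hJ.lt j j.2).le.trans h)
      toDecidableLE := Classical.decRel _ }
  refine ⟨o, z, d, ?_⟩
  exact
    { left := fun j => hJ.left j j.2
      right := fun j => hJ.right j j.2
      le_left := fun j => hJ.le_left j j.2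
      right_le := fun j => hJ.right_le j j.2
      isOreStep := hzd
      right_le_left := by
        intro i j hij
        have hle : i.1.1 ≤ j.1.1 := hij.1
        rcases hJ.separated i i.2 j j.2 with h | h | h
        · exact absurd (by rw [h] : j.1.1 ≤ i.1.1) hij.2
        · exact h
        · exact absurd ((hJ.lt j j.2).trans_le (h.trans hle)) (lt_irrefl _)
      cover := fun n x hxn hxB hxA => by
        obtain ⟨j, hj, h⟩ := hJ.cover n x hxn hxB hxA
        exact ⟨⟨j, hj⟩, h⟩
      exists_least := fun n S hne hact => by
        obtain ⟨_, ⟨m, hm, rfl⟩, hle⟩ := hJ.exists_least n (Subtype.val '' S)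
          (by rintro _ ⟨j, -, rfl⟩; exact j.2) (hne.image _)
          (by rintro _ ⟨j, hj, rfl⟩; exact hact j hj)
        exact ⟨m, hm, fun j hj => hle j ⟨j, hj, rfl⟩⟩ }

/-! ### Ordered monomials: independence and spanning -/

namespace IsPBWFamily

variable {A₀ B₀ : Subalgebra k H} {Γ : Type*} [LinearOrder Γ] {L R : Γ → Subalgebra k H}
  {z : Γ → H} {d : Γ → ℕ}

theorem left_mono (h : IsPBWFamily 𝒜 A₀ B₀ L R z d) {γ δ : Γ} (hγδ : γ ≤ δ) : L γ ≤ L δ := by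
  rcases hγδ.lt_or_eq with hlt | rfl
  · exact (h.isOreStep γ).le.trans (h.right_le_left γ δ hlt)
  · exact le_rfl

theorem lt_of_mem_left (h : IsPBWFamily 𝒜 A₀ B₀ L R z d) {γ δ : Γ} {x : H} (hγ : x ∉ L γ)
    (hδ : x ∈ L δ) : γ < δ :=
  not_le.1 fun hle => hγ (h.left_mono hle hδ)

theorem orderedMonomial_mem_left (h : IsPBWFamily 𝒜 A₀ B₀ L R z d) {a : Γ}
    {w : {l : List Γ // l.Pairwise (· ≤ ·)}} (hw : ∀ γ ∈ w.1, γ < a) :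
    orderedMonomial z w ∈ L a := by
  refine list_prod_mem fun x hx => ?_
  obtain ⟨γ, hγ, rfl⟩ := List.mem_map.1 hx
  exact h.right_le_left γ a (hw γ hγ) (h.isOreStep γ).mem

theorem orderedMonomial_mem_graded (h : IsPBWFamily 𝒜 A₀ B₀ L R z d)
    (w : {l : List Γ // l.Pairwise (· ≤ ·)}) : orderedMonomial z w ∈ 𝒜 (w.1.map d).sum :=
  SetLike.list_prod_map_mem_graded _ _ _ fun γ _ => (h.isOreStep γ).mem_graded

/-- The ordered monomials are linearly independent for any action of elements of `A₀` by
multiplication from the left and from the right. -/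
theorem linearIndependent [CharZero k] (hH : IsConnectedGradedHopf 𝒜)
    (h : IsPBWFamily 𝒜 A₀ B₀ L R z d) {S : Type*} [Ring S] [Module S H]
    (hS : ∀ r : S, ∃ c ∈ A₀, ∃ c' ∈ A₀, ∀ x : H, r • x = c * x * c')
    (hS1 : ∀ r : S, r • (1 : H) = 0 → r = 0) : LinearIndependent S (orderedMonomial z) := by
  classical
  -- A relation involves finitely many indices, so these are added in increasing order: the
  -- monomials known so far lie in `L a` for the new maximum `a`, and its Ore step adds the powers
  -- of `z a`.
  have key : ∀ s : Finset Γ, LinearIndepOn S (orderedMonomial z) {w | ∀ γ ∈ w.1, γ ∈ s} := by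
    intro s
    induction s using Finset.induction_on_max with
    | empty =>
      refine (LinearIndepOn.singleton' (v := orderedMonomial z) (i := ⟨[], List.Pairwise.nil⟩)
        ?_).mono ?_
      · intro r hr
        exact hS1 r (by simpa [orderedMonomial] using hr)
      · intro w hw
        refine Subtype.ext (List.eq_nil_iff_forall_not_mem.2 fun γ hγ => ?_)
        exact absurd (hw γ hγ) (Finset.notMem_empty γ)
    | insert a s hlt ih =>
      have hw : ∀ w : {w : {l : List Γ // l.Pairwise (· ≤ ·)} | ∀ γ ∈ w.1, γ ∈ s},
          ∀ γ ∈ w.1.1, γ < a := fun w γ hγ => hlt γ (w.2 γ hγ)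
      have h1 := (h.isOreStep a).linearIndependent_mul_pow hH (h.left a) (h.right a)
        (R := S)
        (fun r => by
          obtain ⟨c, hc, c', hc', e⟩ := hS r
          exact ⟨c, h.le_left a hc, c', h.le_left a hc', e⟩)
        (fun w => h.orderedMonomial_mem_left (hw w)) ih
      let f : {w : {l : List Γ // l.Pairwise (· ≤ ·)} | ∀ γ ∈ w.1, γ ∈ s} × ℕ →
        {l : List Γ // l.Pairwise (· ≤ ·)} := fun p => appendReplicate p.1.1 a (hw p.1) p.2
      have h2 : LinearIndepOn S (orderedMonomial z ∘ f) Set.univ := by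
        rw [linearIndepOn_univ_iff]
        convert h1 using 2 with p
        exact orderedMonomial_appendReplicate z _ a _ _
      refine (h2.image_of_comp f (orderedMonomial z)).mono fun w hws => ?_
      obtain ⟨w', n, h', hsub, e⟩ := exists_eq_appendReplicate w a fun γ hγ => by
        rcases Finset.mem_insert.1 (hws γ hγ) with rfl | hγ
        · exact le_rfl
        · exact (hlt γ hγ).le
      refine ⟨(⟨w', fun γ hγ => ?_⟩, n), Set.mem_univ _, e.symm⟩
      exact (Finset.mem_insert.1 (hws γ (hsub γ hγ))).resolve_left (h' γ hγ).ne
  rw [linearIndependent_iff']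
  intro t g hg w hw
  refine linearIndepOn_iff'.1 (key (t.biUnion fun w => w.1.toFinset)) t g (fun w hw γ hγ => ?_)
    hg w hw
  exact Finset.mem_biUnion.2 ⟨w, hw, List.mem_toFinset.2 hγ⟩

variable (𝒜 A₀ z d) in
/-- The span of the products `c * w * c'` of degree `n` with homogeneous `c, c' ∈ A₀` related by
`Q` and ordered monomials `w` in the `z γ` with `γ ∈ T`. -/
def monomialSpan (Q : H → H → Prop) (T : Set Γ) (n : ℕ) : Submodule k H :=
  Submodule.span k {x | ∃ (c c' : H) (i j : ℕ) (w : {l : List Γ // l.Pairwise (· ≤ ·)}),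
    Q c c' ∧ c ∈ A₀ ∧ c' ∈ A₀ ∧ c ∈ 𝒜 i ∧ c' ∈ 𝒜 j ∧ (∀ γ ∈ w.1, γ ∈ T) ∧
      i + (w.1.map d).sum + j = n ∧ x = c * orderedMonomial z w * c'}

theorem monomialSpan_mono (Q : H → H → Prop) {T T' : Set Γ} (hT : T ⊆ T') (n : ℕ) :
    monomialSpan 𝒜 A₀ z d Q T n ≤ monomialSpan 𝒜 A₀ z d Q T' n := by
  refine Submodule.span_mono ?_
  rintro _ ⟨c, c', i, j, w, hQ, hc, hc', hci, hcj, hw, hn, rfl⟩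
  exact ⟨c, c', i, j, w, hQ, hc, hc', hci, hcj, fun γ hγ => hT (hw γ hγ), hn, rfl⟩

/-- Write `a` through terms `c w c'` with `w` below `γ`. Then `c w c' z^j = c w z^j c' - c w [z^j,
c']`, where the error has only smaller powers of `z γ` and is covered by induction on `r`. The
coefficients `c, c'` do not change, so `Q` is preserved. -/
theorem powSpan_le_monomialSpan (h : IsPBWFamily 𝒜 A₀ B₀ L R z d) (Q : H → H → Prop) {γ : Γ}
    {n : ℕ} (hL : ∀ i ≤ n, ∀ a ∈ 𝒜 i, a ∈ L γ → a ∈ monomialSpan 𝒜 A₀ z d Q (Set.Iio γ) i)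
    (r : ℕ) : powSpan 𝒜 (L γ) (z γ) (d γ) r n ≤ monomialSpan 𝒜 A₀ z d Q (Set.Iic γ) n := by
  have hO := h.isOreStep γ
  induction r with
  | zero =>
    refine Submodule.span_le.2 ?_
    rintro _ ⟨a, ha, i, j, hai, hj, hn, rfl⟩
    omega
  | succ r ih =>
    refine Submodule.span_le.2 ?_
    rintro _ ⟨a, ha, i, j, hai, hj, hn, rfl⟩
    rcases Nat.lt_succ_iff_lt_or_eq.1 hj with hj | rfl
    · exact ih (mem_powSpan ha hai hj hn)
    suffices hsp : monomialSpan 𝒜 A₀ z d Q (Set.Iio γ) i ≤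
        (monomialSpan 𝒜 A₀ z d Q (Set.Iic γ) n).comap (LinearMap.mulRight k (z γ ^ j)) from
      hsp (hL i (by omega) a hai ha)
    refine Submodule.span_le.2 ?_
    rintro _ ⟨c, c', i₁, i₂, w, hQ, hc, hc', hci, hcj, hw', hi, rfl⟩
    have hw : ∀ δ ∈ w.1, δ < γ := hw'
    change c * orderedMonomial z w * c' * z γ ^ j ∈ monomialSpan 𝒜 A₀ z d Q (Set.Iic γ) n
    have e : c * orderedMonomial z w * c' * z γ ^ j =
        c * orderedMonomial z (appendReplicate w γ hw j) * c' -
          c * orderedMonomial z w * (z γ ^ j * c' - c' * z γ ^ j) := by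
      rw [orderedMonomial_appendReplicate]; noncomm_ring
    rw [e]
    refine sub_mem (Submodule.subset_span ⟨c, c', i₁, i₂, appendReplicate w γ hw j, hQ, hc, hc',
      hci, hcj, ?_, ?_, rfl⟩) (ih ?_)
    · intro δ hδ
      rcases List.mem_append.1 hδ with hδ | hδ
      · exact (hw δ hδ).le
      · exact (List.eq_of_mem_replicate hδ).le
    · simp only [appendReplicate, List.map_append, List.sum_append, List.map_replicate,
        List.sum_replicate, smul_eq_mul]
      rw [← hn, ← hi]
      ring
    · have := ConnGrHopf.mul_mem_powSpan (mul_mem (h.le_left γ hc) (h.orderedMonomial_mem_left hw))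
        (SetLike.mul_mem_graded hci (h.orderedMonomial_mem_graded w))
        (hO.pow_mul_sub_mem (h.le_left γ hc') hcj j)
      rwa [← add_assoc, hi, hn] at this

/-- Strong induction on the degree. Within degree `n`, a least bad step exists because the steps
active in that degree are well-ordered; elements of its left end of degree at most `n` come from
`A₀`, a smaller degree, or an earlier step. -/
theorem mem_monomialSpan (h : IsPBWFamily 𝒜 A₀ B₀ L R z d) {Q : H → H → Prop}
    (hQ : (∀ c, Q c 1) ∨ ∀ c, Q 1 c) {n : ℕ} {x : H} (hxn : x ∈ 𝒜 n) (hx : x ∈ B₀) :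
    x ∈ monomialSpan 𝒜 A₀ z d Q ∅ n ∨
      ∃ γ, x ∈ R γ ∧ x ∉ L γ ∧ x ∈ monomialSpan 𝒜 A₀ z d Q (Set.Iic γ) n := by
  have hA₀ : ∀ {n : ℕ} {x : H}, x ∈ 𝒜 n → x ∈ A₀ → x ∈ monomialSpan 𝒜 A₀ z d Q ∅ n := by
    intro n x hxn hx
    rcases hQ with hQ | hQ
    · exact Submodule.subset_span ⟨x, 1, n, 0, ⟨[], List.Pairwise.nil⟩, hQ x, hx, one_mem _, hxn,
        SetLike.one_mem_graded 𝒜, by simp, by simp, by simp [orderedMonomial]⟩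
    · exact Submodule.subset_span ⟨1, x, 0, n, ⟨[], List.Pairwise.nil⟩, hQ x, one_mem _, hx,
        SetLike.one_mem_graded 𝒜, hxn, by simp, by simp, by simp [orderedMonomial]⟩
  have key : ∀ n, ∀ γ, ∀ x ∈ 𝒜 n, x ∈ R γ → x ∉ L γ →
      x ∈ monomialSpan 𝒜 A₀ z d Q (Set.Iic γ) n := by
    intro n
    induction n using Nat.strong_induction_on with
    | _ n ih =>
      by_contra! hcon
      obtain ⟨γ, ⟨x, hxn, hxR, hxL, hxnot⟩, hmin⟩ := h.exists_least n
        {γ | ∃ x ∈ 𝒜 n, x ∈ R γ ∧ x ∉ L γ ∧ x ∉ monomialSpan 𝒜 A₀ z d Q (Set.Iic γ) n} hcon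
        (fun γ ⟨x, hxn, h2, h1, _⟩ => ⟨x, hxn, h2, h1⟩)
      refine hxnot (h.powSpan_le_monomialSpan Q ?_ (n + 1)
        ((h.isOreStep γ).mem_powSpan_of_mem (h.left γ) hxn hxR))
      intro i hi a hai haL
      by_cases haA : a ∈ A₀
      · exact monomialSpan_mono Q (Set.empty_subset _) i (hA₀ hai haA)
      obtain ⟨δ, hδR, hδL⟩ := h.cover i a hai
        (h.right_le γ ((h.isOreStep γ).le haL)) haA
      have hδγ := h.lt_of_mem_left hδL haL
      refine monomialSpan_mono Q (Set.Iic_subset_Iio.2 hδγ) i ?_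
      rcases hi.lt_or_eq with hi | rfl
      · exact ih i hi δ a hai hδR hδL
      · by_contra hnot
        exact absurd (hmin δ ⟨a, hai, hδR, hδL, hnot⟩) (not_le.2 hδγ)
  by_cases hxA : x ∈ A₀
  · exact Or.inl (hA₀ hxn hxA)
  · obtain ⟨γ, h2, h1⟩ := h.cover n x hxn hx hxA
    exact Or.inr ⟨γ, h2, h1, key n γ x hxn h2 h1⟩

theorem mem_monomialSpan_univ (h : IsPBWFamily 𝒜 A₀ B₀ L R z d) {Q : H → H → Prop}
    (hQ : (∀ c, Q c 1) ∨ ∀ c, Q 1 c) {n : ℕ} {x : H} (hxn : x ∈ 𝒜 n) (hx : x ∈ B₀) :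
    x ∈ monomialSpan 𝒜 A₀ z d Q Set.univ n := by
  rcases h.mem_monomialSpan hQ hxn hx with h | ⟨γ, -, -, h⟩
  · exact monomialSpan_mono Q (Set.subset_univ _) n h
  · exact monomialSpan_mono Q (Set.subset_univ _) n h

/-- A homogeneous element of `L γ` outside `A₀` enters at some `δ < γ`, so it is spanned by
monomials in generators before `γ`. This identifies the abstract chain with the subalgebras of the
theorem. -/
theorem subalgLT_eq (h : IsPBWFamily 𝒜 A₀ B₀ L R z d) (γ : Γ) : subalgLT A₀ z γ = L γ := by
  refine le_antisymm (Algebra.adjoin_le ?_) fun x hx => ?_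
  · rintro _ (hx | ⟨δ, hδ, rfl⟩)
    · exact h.le_left γ hx
    · exact h.right_le_left δ γ hδ (h.isOreStep δ).mem
  · refine homogeneous_induction (𝒜 := 𝒜) (M := Subalgebra.toSubmodule (L γ))
      (fun x hx n => (h.left γ).proj_mem hx n) (P := fun x => x ∈ subalgLT A₀ z γ)
      (zero_mem _) (fun _ _ hx hy => add_mem hx hy) (fun n x hxn hx => ?_) hx
    have hle : monomialSpan 𝒜 A₀ z d (fun _ _ => True) (Set.Iio γ) n ≤
        Subalgebra.toSubmodule (subalgLT A₀ z γ) := by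
      refine Submodule.span_le.2 ?_
      rintro _ ⟨c, c', i, j, w, -, hc, hc', -, -, hw, -, rfl⟩
      change _ ∈ subalgLT A₀ z γ
      refine mul_mem (mul_mem (Algebra.subset_adjoin (Or.inl hc)) ?_)
        (Algebra.subset_adjoin (Or.inl hc'))
      refine list_prod_mem fun y hy => ?_
      obtain ⟨δ, hδ, rfl⟩ := List.mem_map.1 hy
      exact Algebra.subset_adjoin (Or.inr ⟨δ, hw δ hδ, rfl⟩)
    refine hle ?_
    rcases h.mem_monomialSpan (Q := fun _ _ => True) (Or.inl fun _ => trivial) hxn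
      (h.right_le γ ((h.isOreStep γ).le hx)) with h' | ⟨δ, -, hδ, h'⟩
    · exact monomialSpan_mono _ (Set.empty_subset _) n h'
    · exact monomialSpan_mono _ (Set.Iic_subset_Iio.2 (h.lt_of_mem_left hδ hx)) n h'

/-- The ordered monomials span `H` for any action that contains the homogeneous multiplications
by elements of `A₀` from one side. -/
theorem span_eq_top (h : IsPBWFamily 𝒜 A₀ ⊤ L R z d) {Q : H → H → Prop}
    (hQ : (∀ c, Q c 1) ∨ ∀ c, Q 1 c) {S : Type*} [Ring S] [Module S H]
    (hS : ∀ c ∈ A₀, ∀ c' ∈ A₀, Q c c' → ∃ r : S, ∀ x : H, r • x = c * x * c') :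
    Submodule.span S (Set.range (orderedMonomial z)) = ⊤ := by
  refine (Submodule.eq_top_iff').2 fun x => ?_
  refine homogeneous_induction (𝒜 := 𝒜) (M := ⊤) (fun _ _ _ => Submodule.mem_top)
    (P := fun x => x ∈ Submodule.span S (Set.range (orderedMonomial z)))
    (zero_mem _) (fun _ _ hx hy => add_mem hx hy) (fun n x hxn hxt => ?_)
    (Submodule.mem_top : x ∈ (⊤ : Submodule k H))
  have hx := h.mem_monomialSpan_univ hQ hxn Algebra.mem_top
  clear hxn hxt
  induction hx using Submodule.span_induction with
  | mem x hx =>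
    obtain ⟨c, c', i, j, w, hcc', hc, hc', -, -, -, -, rfl⟩ := hx
    obtain ⟨r, hr⟩ := hS c hc c' hc' hcc'
    rw [← hr]
    exact Submodule.smul_mem _ r (Submodule.subset_span ⟨w, rfl⟩)
  | zero => exact zero_mem _
  | add x y _ _ hx hy => exact add_mem hx hy
  | smul a x _ hx =>
    have : ∃ r : S, r • x = a • x := by
      rcases hQ with hQ | hQ
      · obtain ⟨r, hr⟩ := hS (algebraMap k H a) (A₀.algebraMap_mem a) 1 (one_mem _) (hQ _)
        exact ⟨r, by rw [hr, mul_one, Algebra.smul_def]⟩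
      · obtain ⟨r, hr⟩ := hS 1 (one_mem _) (algebraMap k H a) (A₀.algebraMap_mem a) (hQ _)
        exact ⟨r, by rw [hr, one_mul, Algebra.smul_def, Algebra.commutes]⟩
    obtain ⟨r, hr⟩ := this
    rw [← hr]
    exact Submodule.smul_mem _ r hx

end IsPBWFamily

end ConnGrHopf

namespace ConnGrHopf

open Coalgebra

set_option linter.unusedSectionVars false

/-! ### Gelfand-Kirillov dimension -/

theorem fg_sum_pow {k A : Type*} [Field k] [Ring A] [Algebra k A] {V : Submodule k A}
    (hV : V.FG) (n : ℕ) : (∑ i ∈ Finset.range (n + 1), V ^ i).FG :=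
  Finset.sum_induction _ Submodule.FG (fun _ _ ha hb => ha.sup hb) Submodule.fg_bot
    fun i _ => hV.pow i

theorem tendsto_logb_natCast (c : ℝ) :
    Filter.Tendsto (fun n : ℕ => Real.logb n c) Filter.atTop (nhds 0) := by
  simp only [Real.logb]
  exact Filter.Tendsto.const_div_atTop
    (Real.tendsto_log_atTop.comp tendsto_natCast_atTop_atTop) _

/-- The logarithm to base `n` of `(n / c)^r` is `r (1 - log_n c)`, which tends to `r`. -/
theorem le_limsup_logb {u : ℕ → ℕ} {r : ℕ} {c : ℝ} (hc : 0 < c)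
    (h : ∀ n : ℕ, ((n : ℝ) / c) ^ r ≤ u n) :
    (r : ℝ≥0∞) ≤ Filter.limsup (fun n : ℕ => ENNReal.ofReal (Real.logb n (u n)))
      Filter.atTop := by
  have hlim : Filter.Tendsto (fun n : ℕ => ENNReal.ofReal (r * (1 - Real.logb n c)))
      Filter.atTop (nhds (r : ℝ≥0∞)) := by
    have h1 : Filter.Tendsto (fun n : ℕ => (r : ℝ) * (1 - Real.logb n c)) Filter.atTop
        (nhds (r * (1 - 0))) := ((tendsto_logb_natCast c).const_sub 1).const_mul _
    have h2 := ENNReal.tendsto_ofReal h1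
    rwa [sub_zero, mul_one, ENNReal.ofReal_natCast] at h2
  rw [← hlim.limsup_eq]
  refine Filter.limsup_le_limsup ?_
  filter_upwards [Filter.eventually_gt_atTop 1] with n hn
  refine ENNReal.ofReal_le_ofReal ?_
  have hn1 : (1 : ℝ) < n := by exact_mod_cast hn
  have hn0 : (0 : ℝ) < n := by linarith
  have e : (r : ℝ) * (1 - Real.logb n c) = Real.logb n (((n : ℝ) / c) ^ r) := by
    rw [Real.logb_pow, Real.logb_div hn0.ne' hc.ne', Real.logb_self_eq_one hn1]
  rw [e]
  exact Real.logb_le_logb_of_le hn1 (by positivity) (h n)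

theorem limsup_logb_le {u : ℕ → ℕ} {r m : ℕ} (h : ∀ n : ℕ, u n ≤ (n * m + 1) ^ r) :
    Filter.limsup (fun n : ℕ => ENNReal.ofReal (Real.logb n (u n))) Filter.atTop ≤ r := by
  have hlim : Filter.Tendsto (fun n : ℕ => ENNReal.ofReal (r * (1 + Real.logb n (m + 1 : ℝ))))
      Filter.atTop (nhds (r : ℝ≥0∞)) := by
    have h1 : Filter.Tendsto (fun n : ℕ => (r : ℝ) * (1 + Real.logb n (m + 1 : ℝ))) Filter.atTop
        (nhds (r * (1 + 0))) := ((tendsto_logb_natCast _).const_add 1).const_mul _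
    have h2 := ENNReal.tendsto_ofReal h1
    rwa [add_zero, mul_one, ENNReal.ofReal_natCast] at h2
  rw [← hlim.limsup_eq]
  refine Filter.limsup_le_limsup ?_
  filter_upwards [Filter.eventually_gt_atTop 1] with n hn
  refine ENNReal.ofReal_le_ofReal ?_
  have hn1 : (1 : ℝ) < n := by exact_mod_cast hn
  have hn0 : (0 : ℝ) < n := by linarith
  have hm0 : (0 : ℝ) < m + 1 := by positivity
  have e : (r : ℝ) * (1 + Real.logb n (m + 1 : ℝ)) = Real.logb n (((n : ℝ) * (m + 1)) ^ r) := by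
    rw [Real.logb_pow, Real.logb_mul hn0.ne' hm0.ne', Real.logb_self_eq_one hn1]
  -- Monotonicity of the logarithm needs a positive argument; at `0` the default value `0` is
  -- harmless.
  rcases Nat.eq_zero_or_pos (u n) with hu | hu
  · rw [hu, Nat.cast_zero, Real.logb_zero]
    have := Real.logb_nonneg hn1 (x := (m + 1 : ℝ)) (by simp)
    positivity
  · rw [e]
    refine Real.logb_le_logb_of_le hn1 (by exact_mod_cast hu) ?_
    calc (u n : ℝ) ≤ ((n * m + 1 : ℕ) : ℝ) ^ r := by exact_mod_cast h n
      _ ≤ ((n : ℝ) * (m + 1)) ^ r := by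
        gcongr
        push_cast
        nlinarith

section SortedOf

variable {Γ : Type*} [LinearOrder Γ]

/-- The nondecreasing sequence in which each `γ ∈ s` occurs `e γ` times. -/
def sortedOf (s : Finset Γ) (e : Γ → ℕ) : {l : List Γ // l.Pairwise (· ≤ ·)} :=
  ⟨(∑ γ ∈ s, Multiset.replicate (e γ) γ).sort (· ≤ ·), Multiset.pairwise_sort _ _⟩

theorem coe_sortedOf (s : Finset Γ) (e : Γ → ℕ) :
    ((sortedOf s e).1 : Multiset Γ) = ∑ γ ∈ s, Multiset.replicate (e γ) γ :=
  Multiset.sort_eq _ _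

theorem count_sortedOf {s : Finset Γ} (e : Γ → ℕ) {γ : Γ} (hγ : γ ∈ s) :
    (sortedOf s e).1.count γ = e γ := by
  rw [← Multiset.coe_count, coe_sortedOf, Multiset.count_sum',
    Finset.sum_eq_single γ]
  · simp
  · intro δ _ hδ
    simp [Multiset.count_replicate, hδ]
  · intro h
    exact absurd hγ h

theorem length_sortedOf (s : Finset Γ) (e : Γ → ℕ) :
    (sortedOf s e).1.length = ∑ γ ∈ s, e γ := by
  rw [← Multiset.coe_card, coe_sortedOf, Multiset.card_sum]
  simp

theorem mem_of_mem_sortedOf {s : Finset Γ} {e : Γ → ℕ} {γ : Γ} (h : γ ∈ (sortedOf s e).1) :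
    γ ∈ s := by
  rw [← Multiset.mem_coe, coe_sortedOf, Multiset.mem_sum] at h
  obtain ⟨δ, hδ, h⟩ := h
  rwa [Multiset.eq_of_mem_replicate h]

theorem eq_sortedOf [Fintype Γ] (w : {l : List Γ // l.Pairwise (· ≤ ·)}) :
    w = sortedOf Finset.univ fun γ => w.1.count γ := by
  refine Subtype.ext (List.Perm.eq_of_pairwise' w.2 (sortedOf _ _).2 (List.perm_iff_count.2 ?_))
  intro γ
  rw [count_sortedOf _ (Finset.mem_univ γ)]

end SortedOf

section DegLE

variable {k H : Type*} [Field k] [Ring H] [Algebra k H]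
variable (𝒜 : ℕ → Submodule k H) [GradedAlgebra 𝒜]

/-- The elements of degree at most `N`. -/
def degLE (N : ℕ) : Submodule k H where
  carrier := {x | ∀ i, N < i → GradedAlgebra.proj 𝒜 i x = 0}
  add_mem' ha hb i hi := by rw [map_add, ha i hi, hb i hi, add_zero]
  zero_mem' i _ := map_zero _
  smul_mem' c x hx i hi := by rw [map_smul, hx i hi, smul_zero]

variable {𝒜}

theorem degLE_mono {M N : ℕ} (h : M ≤ N) : degLE 𝒜 M ≤ degLE 𝒜 N :=
  fun _ hx i hi => hx i (h.trans_lt hi)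

theorem degLE_mul_le (M N : ℕ) : degLE 𝒜 M * degLE 𝒜 N ≤ degLE 𝒜 (M + N) := by
  refine Submodule.mul_le.2 fun x hx y hy i hi => ?_
  rw [proj_mul]
  refine Finset.sum_eq_zero fun p hp => ?_
  have := Finset.HasAntidiagonal.mem_antidiagonal.1 hp
  by_cases h : M < p.1
  · rw [hx _ h, zero_mul]
  · rw [hy _ (by omega), mul_zero]

theorem pow_le_degLE {V : Submodule k H} {m : ℕ} (hV : V ≤ degLE 𝒜 m) (i : ℕ) :
    V ^ i ≤ degLE 𝒜 (i * m) := by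
  induction i with
  | zero =>
    rw [pow_zero, Submodule.one_le]
    intro j hj
    exact proj_of_mem_ne (SetLike.one_mem_graded 𝒜) (by omega)
  | succ i ih =>
    rw [pow_succ, Nat.succ_mul]
    exact (mul_le_mul' ih hV).trans (degLE_mul_le _ _)

theorem exists_mem_degLE (x : H) : ∃ N, x ∈ degLE 𝒜 N := by
  induction x using DirectSum.Decomposition.inductionOn 𝒜 with
  | zero => exact ⟨0, zero_mem _⟩
  | add a b ha hb =>
    obtain ⟨M, hM⟩ := ha
    obtain ⟨N, hN⟩ := hb
    exact ⟨max M N, add_mem (degLE_mono (le_max_left _ _) hM) (degLE_mono (le_max_right _ _) hN)⟩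
  | homogeneous a =>
    rename_i i
    exact ⟨i, fun j hj => proj_of_mem_ne a.2 hj.ne⟩

theorem exists_le_degLE {V : Submodule k H} (hV : V.FG) : ∃ N, V ≤ degLE 𝒜 N := by
  obtain ⟨S, rfl⟩ := hV
  choose f hf using exists_mem_degLE (𝒜 := 𝒜)
  exact ⟨S.sup f, Submodule.span_le.2 fun x hx => degLE_mono (Finset.le_sup hx) (hf x)⟩

end DegLE

variable {k H : Type*} [Field k] [Ring H] [HopfAlgebra k H]
variable {𝒜 : ℕ → Submodule k H} [GradedAlgebra 𝒜]

theorem smul_one_eq_zero {r : k} (h : r • (1 : H) = 0) : r = 0 := by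
  have := congrArg (counit (R := k)) h
  rwa [map_smul, Bialgebra.counit_one, smul_eq_mul, mul_one, map_zero] at this

namespace IsPBWFamily

variable {B₀ : Subalgebra k H} {Γ : Type*} [LinearOrder Γ] {L R : Γ → Subalgebra k H}
  {z : Γ → H} {d : Γ → ℕ}

theorem linearIndependent_of_bot [CharZero k] (hH : IsConnectedGradedHopf 𝒜)
    (h : IsPBWFamily 𝒜 ⊥ B₀ L R z d) : LinearIndependent k (orderedMonomial z) :=
  h.linearIndependent hH (fun r => ⟨algebraMap k H r, Subalgebra.algebraMap_mem _ r, 1, one_mem _,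
    fun x => by rw [mul_one, Algebra.smul_def]⟩) fun _ hr => smul_one_eq_zero hr

/-- With `r` generators and exponents at most `n / r`, an ordered monomial has length at most `n`
and lies in `V^0 + ⋯ + V^n`. These monomials are independent, and their number is at least `(n /
r)^r`. -/
theorem card_le_gkdim [CharZero k] (hH : IsConnectedGradedHopf 𝒜)
    (h : IsPBWFamily 𝒜 ⊥ B₀ L R z d) {C : Type*} [Ring C] [Algebra k C] {f : C →ₐ[k] H}
    (hf : f.range = B₀) (s : Finset Γ) : (s.card : ℝ≥0∞) ≤ gkdim k C := by
  classical
  rcases s.eq_empty_or_nonempty with rfl | hs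
  · simp
  have hr : 0 < s.card := hs.card_pos
  have hy : ∀ γ, ∃ y, f y = z γ := fun γ => by
    have : z γ ∈ f.range := hf ▸ h.right_le γ (h.isOreStep γ).mem
    exact this
  choose y hy using hy
  set V : Submodule k C := Submodule.span k (s.image y : Finset C) with hV
  have hVfg : V.FG := ⟨_, rfl⟩
  refine le_trans ?_ (le_iSup₂_of_le V (Submodule.fg_iff_finiteDimensional V |>.1 hVfg) le_rfl)
  refine le_limsup_logb (c := s.card) (by exact_mod_cast hr) fun n => ?_
  set W := ∑ i ∈ Finset.range (n + 1), V ^ i with hW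
  have hWfd : FiniteDimensional k W := (Submodule.fg_iff_finiteDimensional W).1 (fg_sum_pow hVfg n)
  set q := n / s.card with hq
  let E : (s → Fin (q + 1)) → Γ → ℕ := fun e γ => if hγ : γ ∈ s then (e ⟨γ, hγ⟩ : ℕ) else 0
  have hE : ∀ e γ, E e γ ≤ q := by
    intro e γ
    simp only [E]
    split_ifs with hγ
    · exact Nat.lt_succ_iff.1 (e ⟨γ, hγ⟩).2
    · exact Nat.zero_le _
  let M : (s → Fin (q + 1)) → C := fun e => ((sortedOf s (E e)).1.map y).prod
  have hfM : ∀ e, f (M e) = orderedMonomial z (sortedOf s (E e)) := by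
    intro e
    simp only [M, orderedMonomial, map_list_prod, List.map_map]
    congr 2
    exact funext hy
  have hinj : Function.Injective fun e : s → Fin (q + 1) => sortedOf s (E e) := by
    intro e e' hee'
    funext γ
    have h1 := count_sortedOf (E e) γ.2
    have h2 := count_sortedOf (E e') γ.2
    have h3 : sortedOf s (E e) = sortedOf s (E e') := hee'
    rw [h3, h2] at h1
    simp only [E, γ.2, dif_pos] at h1
    exact Fin.ext h1.symm
  have hMind : LinearIndependent k M := by
    refine LinearIndependent.of_comp f.toLinearMap ?_
    have : (f.toLinearMap ∘ M) = orderedMonomial z ∘ fun e => sortedOf s (E e) := funext hfM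
    rw [this]
    exact (h.linearIndependent_of_bot hH).comp _ hinj
  have hMW : ∀ e, M e ∈ W := by
    intro e
    have hlen : (sortedOf s (E e)).1.length ≤ n := by
      rw [length_sortedOf]
      calc ∑ γ ∈ s, E e γ ≤ s.card * q := by
            rw [← smul_eq_mul]
            exact Finset.sum_le_card_nsmul _ _ _ fun γ _ => hE e γ
        _ ≤ n := Nat.mul_div_le n s.card
    have hpow : ∀ l : List Γ, (∀ γ ∈ l, γ ∈ s) → (l.map y).prod ∈ V ^ l.length := by
      intro l
      induction l with
      | nil => exact fun _ => Submodule.one_le.1 le_rfl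
      | cons a l ih =>
        intro hl
        rw [List.map_cons, List.prod_cons, List.length_cons, pow_succ']
        refine Submodule.mul_mem_mul (Submodule.subset_span ?_)
          (ih fun γ hγ => hl γ (List.mem_cons_of_mem _ hγ))
        exact Finset.mem_coe.2 (Finset.mem_image_of_mem y (hl a List.mem_cons_self))
    have hle : V ^ (sortedOf s (E e)).1.length ≤ W := by
      rw [hW, ← Finset.add_sum_erase _ _ (Finset.mem_range.2 (Nat.lt_succ_of_le hlen))]
      exact le_sup_left
    exact hle (hpow _ fun γ hγ => mem_of_mem_sortedOf hγ)
  have hcard : (q + 1) ^ s.card ≤ Module.finrank k W := by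
    have hind : LinearIndependent k (fun e => (⟨M e, hMW e⟩ : W)) :=
      LinearIndependent.of_comp W.subtype hMind
    simpa using hind.fintype_card_le_finrank
  calc ((n : ℝ) / s.card) ^ s.card ≤ ((q + 1 : ℕ) : ℝ) ^ s.card := by
        gcongr
        rw [div_le_iff₀ (by exact_mod_cast hr)]
        have := Nat.lt_mul_div_succ n hr
        rw [mul_comm] at this
        exact_mod_cast this.le
    _ ≤ Module.finrank k W := by exact_mod_cast hcard

theorem length_le_sum_degree {A₀ : Subalgebra k H} (h : IsPBWFamily 𝒜 A₀ B₀ L R z d) (l : List Γ) :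
    l.length ≤ (l.map d).sum := by
  induction l with
  | nil => simp
  | cons a l ih =>
    have := (h.isOreStep a).pos
    simp only [List.length_cons, List.map_cons, List.sum_cons]
    omega

/-- Generators have degree at least `1`, so no exponent exceeds the degree of the monomial. -/
theorem mem_span_of_degLE [Fintype Γ] (h : IsPBWFamily 𝒜 ⊥ B₀ L R z d)
    (hB₀ : IsGradedSubbialgebra 𝒜 B₀) {N : ℕ} {x : H} (hx : x ∈ B₀) (hxN : x ∈ degLE 𝒜 N) :
    x ∈ Submodule.span k (Set.range fun e : Γ → Fin (N + 1) =>
      orderedMonomial z (sortedOf Finset.univ fun γ => (e γ : ℕ))) := by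
  refine mem_of_proj_mem (𝒜 := 𝒜) fun i => ?_
  by_cases hi : N < i
  · rw [hxN i hi]
    exact zero_mem _
  have hmem := h.mem_monomialSpan_univ (Q := fun _ _ => True) (Or.inl fun _ => trivial)
    (proj_mem 𝒜 i x) (hB₀.proj_mem hx i)
  refine Submodule.span_le.2 ?_ hmem
  rintro _ ⟨c, c', i₁, i₂, w, -, hc, hc', -, -, -, hn, rfl⟩
  obtain ⟨a, rfl⟩ := Algebra.mem_bot.1 hc
  obtain ⟨a', rfl⟩ := Algebra.mem_bot.1 hc'
  rw [← Algebra.smul_def, ← Algebra.commutes, ← Algebra.smul_def]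
  refine Submodule.smul_mem _ _ (Submodule.smul_mem _ _ (Submodule.subset_span ?_))
  have hcount : ∀ γ, w.1.count γ < N + 1 := fun γ => by
    have h1 := List.count_le_length (a := γ) (l := w.1)
    have h2 := h.length_le_sum_degree w.1
    omega
  exact ⟨fun γ => ⟨w.1.count γ, hcount γ⟩, congrArg (orderedMonomial z) (eq_sortedOf w).symm⟩

/-- If `f(V)` lies in degrees at most `m`, the image of `V^0 + ⋯ + V^n` lies in degrees at most `n
m`, spanned by at most `(n m + 1)^r` monomials, where `r` is the size of `Γ`. -/
theorem gkdim_le_card [Fintype Γ] (h : IsPBWFamily 𝒜 ⊥ B₀ L R z d)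
    (hB₀ : IsGradedSubbialgebra 𝒜 B₀) {C : Type*} [Ring C] [Algebra k C] {f : C →ₐ[k] H}
    (hf : f.range = B₀) (hinj : Function.Injective f) : gkdim k C ≤ (Fintype.card Γ : ℝ≥0∞) := by
  refine iSup₂_le fun V hV => ?_
  have hVfg : V.FG := (Submodule.fg_iff_finiteDimensional V).2 hV
  obtain ⟨m, hm⟩ := exists_le_degLE (𝒜 := 𝒜) (hVfg.map f.toLinearMap)
  refine limsup_logb_le (m := m) fun n => ?_
  set W := ∑ i ∈ Finset.range (n + 1), V ^ i with hW
  let v : (Γ → Fin (n * m + 1)) → H :=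
    fun e => orderedMonomial z (sortedOf Finset.univ fun γ => (e γ : ℕ))
  have hle : W.map f.toLinearMap ≤ Submodule.span k (Set.range v) := by
    rintro _ ⟨x, hx, rfl⟩
    refine h.mem_span_of_degLE hB₀ (hf ▸ ⟨x, rfl⟩) ?_
    suffices hW' : W ≤ (degLE 𝒜 (n * m)).comap f.toLinearMap from hW' hx
    refine Finset.sum_induction _ (fun U => U ≤ (degLE 𝒜 (n * m)).comap f.toLinearMap)
      (fun _ _ ha hb => sup_le ha hb) bot_le fun i hi => ?_
    rw [← Submodule.map_le_iff_le_comap, Submodule.map_pow]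
    exact (pow_le_degLE hm i).trans
      (degLE_mono (Nat.mul_le_mul_right m (Nat.lt_succ_iff.1 (Finset.mem_range.1 hi))))
  calc Module.finrank k W = Module.finrank k (W.map f.toLinearMap) :=
        (LinearEquiv.finrank_eq (Submodule.equivMapOfInjective f.toLinearMap hinj W))
    _ ≤ Module.finrank k (Submodule.span k (Set.range v)) := by
        have : FiniteDimensional k (Submodule.span k (Set.range v)) :=
          FiniteDimensional.span_of_finite k (Set.finite_range v)
        exact Submodule.finrank_mono hle
    _ ≤ Fintype.card (Γ → Fin (n * m + 1)) := finrank_range_le_card v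
    _ = (n * m + 1) ^ Fintype.card Γ := by simp

theorem gkdim_eq_card [CharZero k] (hH : IsConnectedGradedHopf 𝒜)
    (h : IsPBWFamily 𝒜 ⊥ B₀ L R z d) (hB₀ : IsGradedSubbialgebra 𝒜 B₀) {C : Type*} [Ring C]
    [Algebra k C] {f : C →ₐ[k] H} (hf : f.range = B₀) (hinj : Function.Injective f) :
    gkdim k C = (ENat.card Γ : ℝ≥0∞) := by
  rcases finite_or_infinite Γ with hfin | hinf
  · have := Fintype.ofFinite Γ
    rw [ENat.card_eq_coe_fintype_card, ENat.toENNReal_coe]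
    refine le_antisymm (h.gkdim_le_card hB₀ hf hinj) ?_
    simpa using h.card_le_gkdim hH hf Finset.univ
  · rw [ENat.card_eq_top_of_infinite, ENat.toENNReal_top]
    refine ENNReal.eq_top_of_forall_nnreal_le fun r => ?_
    obtain ⟨N, hN⟩ := exists_nat_ge r
    obtain ⟨s, hs⟩ := Infinite.exists_subset_card_eq Γ N
    refine le_trans ?_ (h.card_le_gkdim hH hf s)
    rw [hs]
    exact_mod_cast hN

end IsPBWFamily

end ConnGrHopf

namespace ConnGrHopf

open Coalgebra

/-! ### Additivity of the dimension and the main theorem -/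

variable {k H : Type*} [Field k] [Ring H] [HopfAlgebra k H]
variable {𝒜 : ℕ → Submodule k H} [GradedAlgebra 𝒜]

variable (𝒜) in
theorem isGradedSubbialgebra_bot : IsGradedSubbialgebra 𝒜 (⊥ : Subalgebra k H) where
  homogeneous := by
    refine isHomogeneous_of_le_lowDegree fun N x hx => ?_
    obtain ⟨r, rfl⟩ := Algebra.mem_bot.1 hx
    exact Subalgebra.algebraMap_mem _ r
  comul_mem x hx := by
    obtain ⟨r, rfl⟩ := Algebra.mem_bot.1 hx
    rw [Bialgebra.comul_algebraMap]
    exact Subalgebra.algebraMap_mem _ r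

variable (𝒜) in
theorem isGradedSubbialgebra_top : IsGradedSubbialgebra 𝒜 (⊤ : Subalgebra k H) where
  homogeneous _ _ _ := Algebra.mem_top
  comul_mem x _ := by
    induction comul (R := k) x with
    | zero => exact zero_mem _
    | add a b ha hb => exact add_mem ha hb
    | tmul a b => exact tmul_mem_tensorSubalgebra Algebra.mem_top Algebra.mem_top

theorem IsGradedHopfSubalgebra.isGradedSubbialgebra {K : Subalgebra k H}
    (hK : IsGradedHopfSubalgebra 𝒜 K) : IsGradedSubbialgebra 𝒜 K where
  homogeneous := hK.homogeneous
  comul_mem := hK.comul_mem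

/-- The Gelfand-Kirillov dimensions of `H` and `K` differ by the number of Ore steps that lead
from `K` to `H`. -/
theorem IsJumpSystem.gkdim_eq [CharZero k] (hH : IsConnectedGradedHopf 𝒜) {K : Subalgebra k H}
    (hK : IsGradedSubbialgebra 𝒜 K) {J : Set (Subalgebra k H × Subalgebra k H)}
    (hJ : IsJumpSystem 𝒜 K ⊤ J) (hO : ∀ j ∈ J, ∃ z d, IsOreStep 𝒜 j.1 j.2 z d) :
    gkdim k H = gkdim k K + (ENat.card J : ℝ≥0∞) := by
  obtain ⟨J', hJ', hO'⟩ := exists_isJumpSystem_isOreStep hH (isGradedSubbialgebra_bot 𝒜) hK bot_le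
  have hKdim : gkdim k K = (ENat.card J' : ℝ≥0∞) := by
    obtain ⟨_, z, d, h⟩ := hJ'.exists_isPBWFamily hO'
    exact h.gkdim_eq_card hH hK (f := K.val) K.range_val Subtype.val_injective
  have hHdim : gkdim k H = (ENat.card ↥(J' ∪ J) : ℝ≥0∞) := by
    obtain ⟨_, z, d, h⟩ := (hJ'.append hJ bot_le le_top).exists_isPBWFamily fun j hj =>
      hj.elim (hO' j) (hO j)
    exact h.gkdim_eq_card hH (isGradedSubbialgebra_top 𝒜) (f := AlgHom.id k H)
      (AlgHom.range_eq_top _ |>.2 Function.surjective_id) Function.injective_id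
  -- A common jump would satisfy `j.1 < j.2 ≤ K ≤ j.1`.
  have hdisj : Disjoint J' J := Set.disjoint_left.2 fun j hj' hj =>
    absurd ((hJ'.lt j hj').trans_le ((hJ'.right_le j hj').trans (hJ.le_left j hj))) (lt_irrefl _)
  have hcard : ENat.card ↥(J' ∪ J) = ENat.card J' + ENat.card J := Set.encard_union_eq hdisj
  rw [hHdim, hKdim, hcard, ENat.toENNReal_add]

end ConnGrHopf

end

open ConnGrHopf in
/-- The right `K`-module structure of `H` is written as the left module structure over
`K.op`, the opposite algebra of `K`, acting by `op a • h = h * a`. -/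
theorem theoremA {k : Type u} {H : Type v} [Field k] [CharZero k] [Ring H] [HopfAlgebra k H]
    (𝒜 : ℕ → Submodule k H) [GradedAlgebra 𝒜] (hH : IsConnectedGradedHopf 𝒜)
    (K : Subalgebra k H) (hK : IsGradedHopfSubalgebra 𝒜 K) :
    ∃ (Γ : Type v) (_ : LinearOrder Γ) (z : Γ → H) (d : Γ → ℕ),
      (∀ γ, 0 < d γ ∧ z γ ∈ 𝒜 (d γ)) ∧
      (∀ γ, ∃ t ∈ tensorLT 𝒜 K z γ (d γ),
        Coalgebra.comul (R := k) (z γ) = 1 ⊗ₜ[k] z γ + z γ ⊗ₜ[k] 1 + t) ∧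
      (∀ γ, ∀ a ∈ subalgLT K z γ, z γ * a - a * z γ ∈ subalgLT K z γ) ∧
      ((∀ w, SetLike.IsHomogeneousElem 𝒜 (orderedMonomial z w)) ∧
        (LinearIndependent K (orderedMonomial z) ∧
          Submodule.span K (Set.range (orderedMonomial z)) = ⊤) ∧
        (LinearIndependent K.op (orderedMonomial z) ∧
          Submodule.span K.op (Set.range (orderedMonomial z)) = ⊤)) ∧
      gkdim k H = gkdim k K + (ENat.card Γ : ℝ≥0∞) := by
  have hK' := hK.isGradedSubbialgebra
  obtain ⟨J, hJ, hO⟩ := exists_isJumpSystem_isOreStep hH hK' (isGradedSubbialgebra_top 𝒜) le_top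
  have hdim := hJ.gkdim_eq hH hK' hO
  obtain ⟨_, z, d, h⟩ := hJ.exists_isPBWFamily hO
  have hleft : ∀ (r : K) (x : H), r • x = r.1 * x * 1 := fun r x => by
    rw [mul_one, Subalgebra.smul_def, smul_eq_mul]
  have hright : ∀ (r : K.op) (x : H), r • x = 1 * x * r.1.unop := fun r x => by
    rw [one_mul, Subalgebra.smul_def, MulOpposite.smul_eq_mul_unop]
  refine ⟨J, _, z, d, fun γ => ⟨(h.isOreStep γ).pos, (h.isOreStep γ).mem_graded⟩, fun γ => ?_,
    fun γ a ha => ?_, ⟨fun w => ⟨_, h.orderedMonomial_mem_graded w⟩, ⟨?_, ?_⟩, ?_, ?_⟩, hdim⟩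
  · rw [tensorLT, h.subalgLT_eq]
    exact (h.isOreStep γ).comul_eq
  · rw [h.subalgLT_eq] at ha ⊢
    exact (h.isOreStep γ).commWith_mem a ha
  · refine h.linearIndependent hH (fun r => ⟨r.1, r.2, 1, one_mem _, hleft r⟩) fun r hr => ?_
    rw [hleft, mul_one, mul_one] at hr
    exact Subtype.ext hr
  -- Forcing the right coefficient to be `1` gives left spanning; the mirror choice below gives
  -- right spanning.
  · refine h.span_eq_top (Q := fun _ c' => c' = 1) (Or.inl fun _ => rfl) ?_
    rintro c hc _ - rfl
    exact ⟨⟨c, hc⟩, hleft _⟩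
  · refine h.linearIndependent hH (fun r => ⟨1, one_mem _, r.1.unop, r.2, hright r⟩) fun r hr => ?_
    rw [hright, one_mul, one_mul] at hr
    exact Subtype.ext (MulOpposite.unop_injective hr)
  · refine h.span_eq_top (Q := fun c _ => c = 1) (Or.inr fun _ => rfl) ?_
    rintro _ - c hc rfl
    exact ⟨⟨MulOpposite.op c, hc⟩, hright _⟩
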